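/- **Setting.** Let $(\mathcal Q,d)$ be a Hadamard space (a nonempty complete CAT(0) space) with its Borel $\sigma$-algebra, let $\mathbb P$ be a probability measure with expectation $\mathbb E$, and let $Y$ be a $\mathcal Q$-valued random variable whose law is concentrated on a separable subset of $\mathcal Q$ (automatic if $\mathcal Q$ is separable). Let $Y_1,Y_2,\dots$ be independent copies of $Y$. Let $\tau\colon[0,\infty)\to\mathbb R$ be nondecreasing, convex, and differentiable on $(0,\infty)$ with concave derivative $\tau'$, with $\tau(0)=0$ and $\tau'(x)>0$ for $x>0$. Put $\tau'(0):=\lim_{x\searrow0}\tau'(x)$, let $\tau''(x)$ denote the right derivative of $\tau'$ at $x>0$, and put $\tau''(0):=\lim_{x\searrow0}\tau''(x)\in[0,\infty]$, with $1/\infty:=0$. Assume $\limsup_{x\to\infty}\tau'(x)=\infty$ and $\mathbb E[\tau'(d(Y,o))]<\infty$ for some $o\in\mathcal Q$. Let $$m\in\operatorname*{arg\,min}_{q\in\mathcal Q}\mathbb E[\tau(d(Y,q))-\tau(d(Y,o))],\qquad m_n\in\operatorname*{arg\,min}_{q\in\mathcal Q}\sum_{j=1}^n\tau(d(Y_j,q))\quad(n\ge1),$$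 and let $\chi$ be a median of $d(Y,m)$. **Notation.** For $f\colon[0,\infty)\to[0,\infty)$ let $\sigma_f:=\mathbb E[f(d(Y,m))]$ and $\hat\sigma_f:=\frac1n\sum_{j=1}^nf(d(Y_j,m))$. Let $(\tau')^{-1}(z):=\sup\{x>0:\tau'(x)\le z\}$ with $\sup\emptyset:=0$, and let $$g(x):=\frac1{\tau''(7x)},\qquad h(x):=g\big((\tau')^{-1}(12x)\big),\qquad r_0:=\max\{\chi,\,2(\tau')^{-1}(16\sigma_{\tau'})\},$$ $$S_1:=\max\big\{\sigma_g,\;2h(\sigma_{\tau'}),\;\mathbb E[h(2\hat\sigma_{\tau'})]\big\}\in[0,\infty]$$ ($S_1$ may depend on $n$), and $$R_n:=\mathbb E\big[d(m,m_n)^2\min\{\tau''(2\chi),\,\tau''(2d(m,m_n))\}\big],$$ where the integrand is $0$ if $m_n=m$. **Claim.** (i) If $\lim_{x\searrow0}\tau''(x)=\infty$ and $\mathbb E[\tau'(d(Y,m))^2\,h(\tau'(d(Y,m)))]<\infty$, then there are $\delta_n\in[0,\infty)$ with $\delta_n\to0$ such that, for all $n\ge1$, $$R_n\le\frac{256}{n}\big(\sigma_{(\tau')^2}\,S_1+\delta_n\big).$$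 (ii) Let $\varepsilon>0$. If $\mathbb E[\tau'(d(Y,m))^{2(1+\varepsilon)}\,h(\tau'(d(Y,m)))^{1+\varepsilon}]<\infty$, $\sigma_{g^{1+\varepsilon}}<\infty$, and $\mathbb E[h(2\hat\sigma_{\tau'})^{1+\varepsilon}]<\infty$ for every $n\ge1$, then there are $\delta_n\in[0,\infty)$ with $\delta_n\to0$ such that, for all $n\ge1$, $$R_n\le\frac{256}{n}\Big(\frac{\sigma_{(\tau')^2}}{\tau''(4r_0)}+\delta_n\Big).$$ -/

import Mathlib

open MeasureTheory ProbabilityTheory Filter Topology Set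
open scoped ENNReal NNReal

noncomputable section

namespace FrechetMean

/-- `γ`, restricted to `[0, 1]`, is a constant-speed geodesic from `x` to `y`. -/
def IsGeodesic {Q : Type*} [MetricSpace Q] (γ : ℝ → Q) (x y : Q) : Prop :=
  γ 0 = x ∧ γ 1 = y ∧
    ∀ s ∈ Icc (0 : ℝ) 1, ∀ t ∈ Icc (0 : ℝ) 1, dist (γ s) (γ t) = |s - t| * dist x y

/-- A Hadamard space: a nonempty complete geodesic metric space of nonpositive curvature
in the sense of Alexandrov, i.e. a nonempty complete CAT(0) space. -/
structure IsHadamardSpace (Q : Type*) [MetricSpace Q] : Prop where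
  nonempty : Nonempty Q
  complete : CompleteSpace Q
  exists_geodesic : ∀ x y : Q, ∃ γ : ℝ → Q, IsGeodesic γ x y
  cat_zero : ∀ (x y : Q) (γ : ℝ → Q), IsGeodesic γ x y → ∀ z : Q, ∀ t ∈ Icc (0 : ℝ) 1,
    dist z (γ t) ^ 2 ≤
      (1 - t) * dist z x ^ 2 + t * dist z y ^ 2 - t * (1 - t) * dist x y ^ 2

/-- The transformations: nondecreasing convex functions on `[0, ∞)`, differentiable on `(0, ∞)`
with concave derivative, that vanish at `0` and have a positive derivative on `(0, ∞)`.
The values of `τ` at negative numbers play no role. -/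
structure IsTransformation (τ : ℝ → ℝ) : Prop where
  monotone : MonotoneOn τ (Ici 0)
  convex : ConvexOn ℝ (Ici 0) τ
  differentiable : ∀ x : ℝ, 0 < x → DifferentiableAt ℝ τ x
  deriv_concave : ConcaveOn ℝ (Ioi 0) (deriv τ)
  map_zero : τ 0 = 0
  deriv_pos : ∀ x : ℝ, 0 < x → 0 < deriv τ x

/-- The derivative `τ'` on `[0, ∞)`, where `τ'(0)` is the limit of `τ'(x)` for `x ↘ 0`. -/
def dtran (τ : ℝ → ℝ) (x : ℝ) : ℝ :=
  if 0 < x then deriv τ x else limUnder (𝓝[>] (0 : ℝ)) (deriv τ)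

/-- The right derivative `τ''` of `τ'` on `(0, ∞)`, a number in `[0, ∞)`, extended to `0` by
its limit for `x ↘ 0`, which is a number in `[0, ∞]`. -/
def ddtran (τ : ℝ → ℝ) (x : ℝ) : ℝ≥0∞ :=
  if 0 < x then ENNReal.ofReal (derivWithin (dtran τ) (Ioi x) x)
  else limUnder (𝓝[>] (0 : ℝ))
    (fun y : ℝ => ENNReal.ofReal (derivWithin (dtran τ) (Ioi y) y))

/-- The generalized inverse of `τ'`; the supremum of the empty set is `0`. -/
def invdtran (τ : ℝ → ℝ) (z : ℝ) : ℝ := sSup {x : ℝ | 0 < x ∧ dtran τ x ≤ z}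

/-- `g(x) = 1 / τ''(7 x)`. -/
def gFun (τ : ℝ → ℝ) (x : ℝ) : ℝ≥0∞ := (ddtran τ (7 * x))⁻¹

/-- `h(x) = g((τ')⁻¹(12 x))`. -/
def hFun (τ : ℝ → ℝ) (x : ℝ) : ℝ≥0∞ := gFun τ (invdtran τ (12 * x))

section Probability

variable {Ω Q : Type*} [MeasurableSpace Ω] [MetricSpace Q]

/-- `m` is a population `τ`-Fréchet mean of `Y` (`o` is the reference point). -/
def IsFrechetMean (τ : ℝ → ℝ) (P : Measure Ω) (Y : Ω → Q) (o m : Q) : Prop :=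
  ∀ q : Q, ∫ ω, (τ (dist (Y ω) m) - τ (dist (Y ω) o)) ∂P ≤
    ∫ ω, (τ (dist (Y ω) q) - τ (dist (Y ω) o)) ∂P

/-- `q₀` is a sample `τ`-Fréchet mean of the `n` points `y 0, …, y (n - 1)`. -/
def IsSampleFrechetMean (τ : ℝ → ℝ) (n : ℕ) (y : ℕ → Q) (q₀ : Q) : Prop :=
  ∀ q : Q, ∑ j ∈ Finset.range n, τ (dist (y j) q₀) ≤ ∑ j ∈ Finset.range n, τ (dist (y j) q)

/-- `χ` is a median of the real random variable `X`. -/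
def IsMedian (P : Measure Ω) (X : Ω → ℝ) (χ : ℝ) : Prop :=
  1 / 2 ≤ P {ω | X ω ≤ χ} ∧ 1 / 2 ≤ P {ω | χ ≤ X ω}

/-- The moment `σ_f = E[f(d(Y, m))]` of a nonnegative function `f`. -/
def distMoment (P : Measure Ω) (Y : Ω → Q) (m : Q) (f : ℝ → ℝ≥0∞) : ℝ≥0∞ :=
  ∫⁻ ω, f (dist (Y ω) m) ∂P

/-- The moment `σ_{τ'} = E[τ'(d(Y, m))]` as a real number. -/
def sigma (τ : ℝ → ℝ) (P : Measure Ω) (Y : Ω → Q) (m : Q) : ℝ :=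
  ∫ ω, dtran τ (dist (Y ω) m) ∂P

/-- The empirical moment of `τ'` about `m` of the `n` points `y 0, …, y (n - 1)`. -/
def sigmaHat (τ : ℝ → ℝ) (n : ℕ) (y : ℕ → Q) (m : Q) : ℝ :=
  (1 / (n : ℝ)) * ∑ j ∈ Finset.range n, dtran τ (dist (y j) m)

/-- `S_p`, for the sample size `n`. -/
def SMax (τ : ℝ → ℝ) (P : Measure Ω) (Y : Ω → Q) (Ys : ℕ → Ω → Q) (m : Q) (p : ℝ) (n : ℕ) :
    ℝ≥0∞ :=
  max (distMoment P Y m (fun x => gFun τ x ^ p))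
    (max (2 * hFun τ (sigma τ P Y m) ^ p)
      (∫⁻ ω, hFun τ (2 * sigmaHat τ n (fun j => Ys j ω) m) ^ p ∂P))

/-- The radius `r₀`. -/
def rZero (τ : ℝ → ℝ) (P : Measure Ω) (Y : Ω → Q) (m : Q) (χ : ℝ) : ℝ :=
  max χ (2 * invdtran τ (16 * sigma τ P Y m))

/-- The risk `E[d(m, mₙ)² min(τ''(2 χ), τ''(2 d(m, mₙ)))]` of an estimator `mₙ` of `m`. -/
def risk (τ : ℝ → ℝ) (P : Measure Ω) (m : Q) (χ : ℝ) (mn : Ω → Q) : ℝ≥0∞ :=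
  ∫⁻ ω, ENNReal.ofReal (dist m (mn ω) ^ 2) *
    min (ddtran τ (2 * χ)) (ddtran τ (2 * dist m (mn ω))) ∂P

end Probability

end FrechetMean

end

open FrechetMean

/-! The risk is at most four times the expected excess E[τ(d(Y,q)) - τ(d(Y,m))] at q = m_n, with Y
independent of the sample. In a CAT(0) space, τ(d(z,·)) is convex along geodesics, and strongly
convex with modulus τ''(R) while the distance to z stays below R, because τ'' is nonincreasing.
Since d(Y,m) ≤ χ with probability at least 1/2, the population objective grows quadratically away
from m (`variance_inequality`), and χ + d ≤ 2 max(χ,d) produces the minimum in the risk.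

The excess is controlled by leave-one-out stability. For n+1 exchangeable points it is the expected
average of τ(d(y_i,q_i)) - τ(d(y_i,m)), where q_i is the mean without y_i. The mean p of all points
beats m on the full sum, so p may replace m there. Adding the growth inequalities at q_i and p
bounds n τ'' d(q_i,p)² by the difference τ(d(y_i,q_i)) - τ(d(y_i,p)), which in turn is at most
d(q_i,p) τ'(d(y_i,q_i)); hence it is of order τ'(d(y_i,q_i))²/(n τ'') (`leaveOneOut_diff_le`). By
Markov's inequality most points lie within a radius governed by the average s of τ'(d(y_j,m)), so
the curvature enters at 2(τ')⁻¹(6s) and not at the largest distance. With X_j = τ'(d(Y_j,m)) and s =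
σ̂ + X_n/n, `risk_le` bounds the risk by (120/n) E[X_n² / τ''(2(τ')⁻¹(6s))].

It remains to decouple X_n from σ̂, which are independent. For (i), a split by the larger of σ̂ and
X_n/n leaves the remainder E[Z² h(Z/n)], Z = τ'(d(Y,m)), which vanishes by dominated convergence.
For (ii), s exceeds twice its limit only on rare events, whose contribution vanishes by the
single-big-jump estimate `tendsto_lintegral_mean_tail`; this needs only E[Z² h(Z)] < ∞, which the
ε-moments imply. -/

namespace FrechetMean

/-- The right derivative of `τ'` as a real function. -/
noncomputable def rderiv (τ : ℝ → ℝ) (x : ℝ) : ℝ := derivWithin (dtran τ) (Ioi x) x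

lemma ddtran_of_pos (τ : ℝ → ℝ) {x : ℝ} (hx : 0 < x) :
    ddtran τ x = ENNReal.ofReal (rderiv τ x) := by
  simp [ddtran, rderiv, hx]

lemma dtran_of_pos (τ : ℝ → ℝ) {x : ℝ} (hx : 0 < x) : dtran τ x = deriv τ x := by
  simp [dtran, hx]

lemma dtran_of_nonpos (τ : ℝ → ℝ) {x : ℝ} (hx : x ≤ 0) : dtran τ x = dtran τ 0 := by
  simp [dtran, hx.not_gt]

lemma ddtran_of_nonpos (τ : ℝ → ℝ) {x : ℝ} (hx : x ≤ 0) : ddtran τ x = ddtran τ 0 := by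
  simp [ddtran, hx.not_gt]

lemma exists_lt_dtran_of_limsup {τ : ℝ → ℝ}
    (h : limsup (fun x : ℝ => (dtran τ x : EReal)) atTop = ⊤) (B : ℝ) :
    ∃ x, 0 < x ∧ B < dtran τ x := by
  have h1 : ((B : ℝ) : EReal) < limsup (fun x : ℝ => (dtran τ x : EReal)) atTop := by
    rw [h]; exact EReal.coe_lt_top B
  have h2 := frequently_lt_of_lt_limsup (by isBoundedDefault) h1
  obtain ⟨x, hx, hx0⟩ := (h2.and_eventually (eventually_gt_atTop 0)).exists
  exact ⟨x, hx0, by exact_mod_cast hx⟩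

/-! ### Calculus of τ, τ' and τ''. -/

namespace IsTransformation

variable {τ : ℝ → ℝ} (hτ : IsTransformation τ)
include hτ

lemma continuousOn : ContinuousOn τ (Ici 0) := by
  intro x hx
  rcases eq_or_lt_of_le (show (0 : ℝ) ≤ x from hx) with rfl | hx
  -- Differentiability is not available at 0; there convexity squeezes 0 ≤ τ(y) ≤ y τ(1).
  · have h1 : Tendsto (fun x : ℝ => x * τ 1) (𝓝[Ici 0] 0) (𝓝 (τ 0)) := by
      rw [hτ.map_zero]
      have : Continuous fun x : ℝ => x * τ 1 := by fun_prop
      have h := (this.tendsto 0).mono_left (nhdsWithin_le_nhds (s := Ici 0))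
      rwa [zero_mul] at h
    refine tendsto_of_tendsto_of_tendsto_of_le_of_le' tendsto_const_nhds h1 ?_ ?_
    · filter_upwards [self_mem_nhdsWithin] with y hy
      exact hτ.monotone (by simp) hy hy
    · have : Iio (1 : ℝ) ∈ 𝓝[Ici 0] (0 : ℝ) := mem_nhdsWithin_of_mem_nhds (Iio_mem_nhds one_pos)
      filter_upwards [self_mem_nhdsWithin, this] with y hy hy1
      have h := hτ.convex.2 (show (0 : ℝ) ∈ Ici 0 by simp) (show (1 : ℝ) ∈ Ici 0 by simp)
        (sub_nonneg.2 (le_of_lt hy1)) hy (sub_add_cancel 1 y)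
      simpa [hτ.map_zero] using h
  · exact (hτ.differentiable x hx).continuousAt.continuousWithinAt

lemma deriv_monotoneOn : MonotoneOn (deriv τ) (Ioi 0) := by
  have h := (hτ.convex.subset Ioi_subset_Ici_self (convex_Ioi 0)).monotoneOn_deriv
    (fun x hx => hτ.differentiable x hx)
  exact h

lemma bddBelow_deriv : BddBelow (deriv τ '' Ioi 0) :=
  ⟨0, by rintro _ ⟨x, hx, rfl⟩; exact (hτ.deriv_pos x hx).le⟩

lemma tendsto_deriv_zero : Tendsto (deriv τ) (𝓝[>] 0) (𝓝 (sInf (deriv τ '' Ioi 0))) :=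
  hτ.deriv_monotoneOn.tendsto_nhdsGT hτ.bddBelow_deriv

lemma dtran_zero : dtran τ 0 = sInf (deriv τ '' Ioi 0) := by
  simp only [dtran, lt_irrefl, if_false]
  exact hτ.tendsto_deriv_zero.limUnder_eq

lemma dtran_zero_le {x : ℝ} (hx : 0 < x) : dtran τ 0 ≤ dtran τ x := by
  rw [hτ.dtran_zero, dtran_of_pos τ hx]
  exact csInf_le hτ.bddBelow_deriv ⟨x, hx, rfl⟩

lemma dtran_mono : Monotone (dtran τ) := by
  intro x y hxy
  rcases le_or_gt x 0 with hx | hx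
  · rw [dtran_of_nonpos τ hx]
    rcases le_or_gt y 0 with hy | hy
    · rw [dtran_of_nonpos τ hy]
    · exact hτ.dtran_zero_le hy
  · rw [dtran_of_pos τ hx, dtran_of_pos τ (hx.trans_le hxy)]
    exact hτ.deriv_monotoneOn hx (hx.trans_le hxy) hxy

lemma dtran_pos {x : ℝ} (hx : 0 < x) : 0 < dtran τ x := by
  rw [dtran_of_pos τ hx]; exact hτ.deriv_pos x hx

lemma dtran_zero_nonneg : 0 ≤ dtran τ 0 := by
  rw [hτ.dtran_zero]
  exact le_csInf (nonempty_Ioi.image _) (by rintro _ ⟨x, hx, rfl⟩; exact (hτ.deriv_pos x hx).le)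

lemma dtran_nonneg (x : ℝ) : 0 ≤ dtran τ x := by
  rcases le_or_gt x 0 with hx | hx
  · rw [dtran_of_nonpos τ hx]; exact hτ.dtran_zero_nonneg
  · exact (hτ.dtran_pos hx).le

lemma tendsto_dtran_zero : Tendsto (dtran τ) (𝓝[>] 0) (𝓝 (dtran τ 0)) := by
  rw [hτ.dtran_zero]
  refine hτ.tendsto_deriv_zero.congr' ?_
  filter_upwards [self_mem_nhdsWithin] with x hx
  exact (dtran_of_pos τ hx).symm

lemma dtran_concave : ConcaveOn ℝ (Ioi 0) (dtran τ) :=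
  hτ.deriv_concave.congr fun _ hx => (dtran_of_pos τ hx).symm

lemma hasDerivWithinAt_dtran {x : ℝ} (hx : 0 < x) :
    HasDerivWithinAt (dtran τ) (rderiv τ x) (Ioi x) x := by
  have h := hτ.dtran_concave.neg.hasDerivWithinAt_rightDeriv_of_mem_interior
    (x := x) (by simpa using hx)
  have h2 := h.neg
  rw [neg_neg] at h2
  exact h2.differentiableWithinAt.hasDerivWithinAt

lemma rderiv_nonneg (x : ℝ) : 0 ≤ rderiv τ x :=
  hτ.dtran_mono.monotoneOn _ |>.derivWithin_nonneg

lemma slope_le_rderiv {x y : ℝ} (hx : 0 < x) (hxy : x < y) :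
    dtran τ y ≤ dtran τ x + rderiv τ x * (y - x) := by
  have h := hτ.dtran_concave.slope_le_of_hasDerivWithinAt_Ioi hx (hx.trans hxy) hxy
    (hτ.hasDerivWithinAt_dtran hx)
  rw [slope_def_field, div_le_iff₀ (by linarith)] at h
  linarith

lemma rderiv_le_slope {x y : ℝ} (hy : 0 < y) (hyx : y < x) :
    rderiv τ x * (x - y) ≤ dtran τ x - dtran τ y := by
  have hx := hy.trans hyx
  have h := hτ.hasDerivWithinAt_dtran hx
  rw [hasDerivWithinAt_iff_tendsto_slope' (by simp)] at h
  have h2 : rderiv τ x ≤ (dtran τ x - dtran τ y) / (x - y) := by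
    refine le_of_tendsto h ?_
    filter_upwards [self_mem_nhdsWithin] with z hz
    rw [slope_def_field]
    exact hτ.dtran_concave.slope_anti_adjacent hy (hx.trans hz) hyx hz
  rwa [le_div_iff₀ (by linarith)] at h2

/-- The supporting line of the concave function τ', extended to y = 0 by a limit. Monotonicity of
τ'' and the comparisons of τ' at different points all derive from it. -/
lemma dtran_le_support {x y : ℝ} (hx : 0 < x) (hy : 0 ≤ y) :
    dtran τ y ≤ dtran τ x + rderiv τ x * (y - x) := by
  have key : ∀ z, 0 < z → dtran τ z ≤ dtran τ x + rderiv τ x * (z - x) := by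
    intro z hz
    rcases lt_trichotomy z x with h | rfl | h
    · linarith [hτ.rderiv_le_slope hz h]
    · simp
    · exact hτ.slope_le_rderiv hx h
  rcases eq_or_lt_of_le hy with rfl | hy
  · have h1 : Tendsto (fun y => dtran τ x + rderiv τ x * (y - x)) (𝓝[>] 0)
        (𝓝 (dtran τ x + rderiv τ x * (0 - x))) :=
      (Continuous.tendsto (by fun_prop) 0).mono_left nhdsWithin_le_nhds
    refine le_of_tendsto_of_tendsto hτ.tendsto_dtran_zero h1 ?_
    filter_upwards [self_mem_nhdsWithin] with z hz using key z hz
  · exact key y hy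

lemma rderiv_antitone {x y : ℝ} (hx : 0 < x) (hxy : x ≤ y) : rderiv τ y ≤ rderiv τ x := by
  rcases eq_or_lt_of_le hxy with rfl | h
  · rfl
  have h1 := hτ.dtran_le_support hx (hx.le.trans hxy)
  have h2 := hτ.dtran_le_support (hx.trans h) hx.le
  nlinarith

lemma mul_rderiv_le {x : ℝ} (hx : 0 < x) : x * rderiv τ x ≤ dtran τ x := by
  have := hτ.dtran_le_support hx le_rfl
  linarith [hτ.dtran_zero_nonneg]

/-- Concavity and τ'(0) ≥ 0 make τ'(x)/x nonincreasing; the product form also covers x = 0.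
Subadditivity of τ' follows. -/
lemma mul_dtran_le {x y : ℝ} (hx : 0 ≤ x) (hxy : x ≤ y) : x * dtran τ y ≤ y * dtran τ x := by
  rcases eq_or_lt_of_le hx with rfl | hx
  · simpa using mul_nonneg hxy (hτ.dtran_nonneg 0)
  have h1 := hτ.dtran_le_support hx (hx.le.trans hxy)
  have h2 := hτ.mul_rderiv_le hx
  nlinarith [sub_nonneg.2 hxy]

lemma dtran_add_le {x y : ℝ} (hx : 0 ≤ x) (hy : 0 ≤ y) :
    dtran τ (x + y) ≤ dtran τ x + dtran τ y := by
  rcases eq_or_lt_of_le (add_nonneg hx hy) with h | h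
  · have hx0 : x = 0 := by linarith
    have hy0 : y = 0 := by linarith
    subst hx0 hy0
    simpa using hτ.dtran_nonneg 0
  have h1 := hτ.mul_dtran_le hx (y := x + y) (by linarith)
  have h2 := hτ.mul_dtran_le hy (y := x + y) (by linarith)
  nlinarith

lemma hasDerivAt {x : ℝ} (hx : 0 < x) : HasDerivAt τ (dtran τ x) x := by
  rw [dtran_of_pos τ hx]; exact (hτ.differentiable x hx).hasDerivAt

lemma nonneg {x : ℝ} (hx : 0 ≤ x) : 0 ≤ τ x := by
  simpa [hτ.map_zero] using hτ.monotone (by simp) hx hx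

lemma sub_le {x y : ℝ} (hx : 0 ≤ x) (hxy : x ≤ y) : τ y - τ x ≤ (y - x) * dtran τ y := by
  rcases eq_or_lt_of_le hxy with rfl | h
  · simp
  obtain ⟨c, hc, hce⟩ := exists_hasDerivAt_eq_slope τ (dtran τ) h
    (hτ.continuousOn.mono fun z hz => hx.trans hz.1)
    (fun z hz => hτ.hasDerivAt (hx.trans_lt hz.1))
  have := hτ.dtran_mono hc.2.le
  rw [hce, div_le_iff₀ (by linarith)] at this
  linarith

lemma abs_sub_le {x y R : ℝ} (hx : 0 ≤ x) (hy : 0 ≤ y) (hxR : x ≤ R) (hyR : y ≤ R) :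
    |τ x - τ y| ≤ |x - y| * dtran τ R := by
  wlog h : x ≤ y generalizing x y
  · rw [abs_sub_comm, abs_sub_comm x]; exact this hy hx hyR hxR (le_of_not_ge h)
  have h1 := hτ.sub_le hx h
  have h2 := hτ.monotone hx hy h
  rw [abs_sub_comm, abs_of_nonneg (by linarith), abs_sub_comm, abs_of_nonneg (by linarith)]
  exact h1.trans (mul_le_mul_of_nonneg_left (hτ.dtran_mono hyR) (by linarith))

/-- On [0, x] the derivative τ'(u) lies above the chord u τ'(x)/x; integration of the chord gives
the factor 1/2. -/
lemma half_mul_dtran_le {x : ℝ} (hx : 0 ≤ x) : x * dtran τ x / 2 ≤ τ x := by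
  rcases eq_or_lt_of_le hx with rfl | hx
  · simp [hτ.map_zero]
  have h : MonotoneOn (fun u => τ u - u ^ 2 / 2 * (dtran τ x / x)) (Icc 0 x) := by
    apply monotoneOn_of_hasDerivWithinAt_nonneg (f' := fun u => dtran τ u - u * (dtran τ x / x))
      (convex_Icc 0 x)
    · exact (hτ.continuousOn.mono fun z hz => hz.1).sub (by fun_prop)
    · intro u hu
      rw [interior_Icc] at hu
      have := ((hτ.hasDerivAt hu.1).sub
        ((((hasDerivAt_id u).pow 2).div_const 2).mul_const (dtran τ x / x)))
      refine (this.congr_deriv ?_).hasDerivWithinAt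
      simp
    · intro u hu
      rw [interior_Icc] at hu
      have := hτ.mul_dtran_le hu.1.le hu.2.le
      rw [← mul_div_assoc, sub_nonneg, div_le_iff₀ hx]
      linarith
  have := h ⟨le_rfl, hx.le⟩ ⟨hx.le, le_rfl⟩ hx.le
  simp only [hτ.map_zero] at this
  have e : x ^ 2 / 2 * (dtran τ x / x) = x * dtran τ x / 2 := by field_simp
  rw [e] at this
  norm_num at this
  linarith

/-- Used with D = d(q,m), d = d(y,m), e = d(y,q): moving the reference from m to q costs a term
linear in τ'(d(y,m)). If D ≥ d, the increment of τ is at most d τ'(D), and `mul_dtran_le` exchanges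
the roles of D and d. -/
lemma add_sub_le {D d e : ℝ} (hD : 0 ≤ D) (hd : 0 ≤ d) (he : |D - d| ≤ e) :
    τ D + τ d - τ e ≤ 2 * D * dtran τ d := by
  have he0 : 0 ≤ e := (abs_nonneg _).trans he
  have hm := hτ.monotone (abs_nonneg (D - d)) he0 he
  rcases le_total D d with h | h
  · rw [abs_of_nonpos (by linarith)] at hm
    have h1 := hτ.sub_le (x := -(D - d)) (y := d) (by linarith) (by linarith)
    have h2 := hτ.sub_le le_rfl hD
    rw [hτ.map_zero] at h2
    have h3 := mul_le_mul_of_nonneg_left (hτ.dtran_mono h) hD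
    nlinarith
  · rw [abs_of_nonneg (by linarith)] at hm
    have h1 := hτ.sub_le (x := D - d) (y := D) (by linarith) (by linarith)
    have h2 := hτ.sub_le le_rfl hd
    rw [hτ.map_zero] at h2
    have h3 := hτ.mul_dtran_le hd h
    have h4 := mul_le_mul_of_nonneg_right h (hτ.dtran_nonneg d)
    nlinarith

/-- Together with the convexity below, this splits τ on [0, R] into a nondecreasing convex function
and a multiple of the square, since τ'' ≥ τ''(R) there. The first part composes with the convex
distance, the second with the CAT(0) inequality. -/
lemma sub_sq_monotoneOn (R : ℝ) :
    MonotoneOn (fun u => τ u - u ^ 2 / 2 * rderiv τ R) (Icc 0 R) := by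
  apply monotoneOn_of_hasDerivWithinAt_nonneg (f' := fun u => dtran τ u - u * rderiv τ R)
    (convex_Icc 0 R)
  · exact (hτ.continuousOn.mono fun z hz => hz.1).sub (by fun_prop)
  · intro u hu
    rw [interior_Icc] at hu
    have := ((hτ.hasDerivAt hu.1).sub
      ((((hasDerivAt_id u).pow 2).div_const 2).mul_const (rderiv τ R)))
    refine (this.congr_deriv ?_).hasDerivWithinAt
    simp
  · intro u hu
    rw [interior_Icc] at hu
    have h1 := hτ.mul_rderiv_le hu.1
    have h2 := mul_le_mul_of_nonneg_left (hτ.rderiv_antitone hu.1 hu.2.le) hu.1.le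
    linarith

lemma sub_sq_convexOn (R : ℝ) :
    ConvexOn ℝ (Icc 0 R) (fun u => τ u - u ^ 2 / 2 * rderiv τ R) := by
  have hd : ∀ u ∈ Ioo 0 R, HasDerivAt (fun u => τ u - u ^ 2 / 2 * rderiv τ R)
      (dtran τ u - u * rderiv τ R) u := by
    intro u hu
    have := ((hτ.hasDerivAt hu.1).sub
      ((((hasDerivAt_id u).pow 2).div_const 2).mul_const (rderiv τ R)))
    refine this.congr_deriv ?_
    simp
  apply MonotoneOn.convexOn_of_deriv (convex_Icc 0 R)
  · exact (hτ.continuousOn.mono fun z hz => hz.1).sub (by fun_prop)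
  · rw [interior_Icc]
    exact fun u hu => (hd u hu).differentiableAt.differentiableWithinAt
  · rw [interior_Icc]
    intro u hu v hv huv
    rw [(hd u hu).deriv, (hd v hv).deriv]
    have h1 := hτ.dtran_le_support hv.1 hu.1.le
    have h2 := mul_le_mul_of_nonneg_right (hτ.rderiv_antitone hv.1 hv.2.le) (sub_nonneg.2 huv)
    nlinarith

/-- A horizontal supporting line would bound τ' from above. -/
lemma rderiv_pos (hU : ∀ B, ∃ x, 0 < x ∧ B < dtran τ x) {x : ℝ} (hx : 0 < x) :
    0 < rderiv τ x := by
  refine lt_of_le_of_ne (hτ.rderiv_nonneg x) fun h => ?_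
  obtain ⟨y, hy, hlt⟩ := hU (dtran τ x)
  have := hτ.dtran_le_support hx hy.le
  rw [← h] at this
  linarith

lemma tendsto_ddtran_zero : Tendsto (fun y : ℝ => ENNReal.ofReal (rderiv τ y)) (𝓝[>] 0)
    (𝓝 (ddtran τ 0)) := by
  have h : AntitoneOn (fun y : ℝ => ENNReal.ofReal (rderiv τ y)) (Ioi 0) := fun x hx y _ hxy =>
    ENNReal.ofReal_le_ofReal (hτ.rderiv_antitone hx hxy)
  have h2 := h.tendsto_nhdsGT (OrderTop.bddAbove _)
  have h3 := h2
  rw [← h2.limUnder_eq] at h3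
  simp only [ddtran, lt_irrefl, if_false]
  exact h3

lemma ddtran_antitone : Antitone (ddtran τ) := by
  intro x y hxy
  rcases le_or_gt x 0 with hx | hx
  · rw [ddtran_of_nonpos τ hx]
    rcases le_or_gt y 0 with hy | hy
    · rw [ddtran_of_nonpos τ hy]
    · refine ge_of_tendsto hτ.tendsto_ddtran_zero ?_
      filter_upwards [Ioo_mem_nhdsGT hy] with z hz
      rw [ddtran_of_pos τ hy]
      exact ENNReal.ofReal_le_ofReal (hτ.rderiv_antitone hz.1 hz.2.le)
  · rw [ddtran_of_pos τ hx, ddtran_of_pos τ (hx.trans_le hxy)]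
    exact ENNReal.ofReal_le_ofReal (hτ.rderiv_antitone hx hxy)

lemma ddtran_ne_zero (hU : ∀ B, ∃ x, 0 < x ∧ B < dtran τ x) (x : ℝ) : ddtran τ x ≠ 0 := by
  have h : ddtran τ (max x 1) ≤ ddtran τ x := hτ.ddtran_antitone (le_max_left _ _)
  have h1 : (0 : ℝ) < max x 1 := lt_max_of_lt_right one_pos
  rw [ddtran_of_pos τ h1] at h
  exact ((ENNReal.ofReal_pos.2 (hτ.rderiv_pos hU h1)).trans_le h).ne'

/-! ### The generalized inverse of τ' and the functions g and h. -/

section Inverse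

variable (hU : ∀ B, ∃ x, 0 < x ∧ B < dtran τ x)
include hU

lemma bddAbove_invdtran (z : ℝ) : BddAbove {x : ℝ | 0 < x ∧ dtran τ x ≤ z} := by
  obtain ⟨B, _, hlt⟩ := hU z
  refine ⟨B, fun x hx => ?_⟩
  by_contra! h
  linarith [hτ.dtran_mono h.le, hx.2]

omit hτ hU in
lemma _root_.FrechetMean.invdtran_nonneg (z : ℝ) : 0 ≤ invdtran τ z :=
  Real.sSup_nonneg fun _ hx => hx.1.le

lemma le_invdtran {x z : ℝ} (h : dtran τ x ≤ z) : x ≤ invdtran τ z := by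
  rcases le_or_gt x 0 with hx | hx
  · exact hx.trans (invdtran_nonneg z)
  · exact le_csSup (hτ.bddAbove_invdtran hU z) ⟨hx, h⟩

lemma invdtran_mono : Monotone (invdtran τ) := by
  intro y z hyz
  refine Real.sSup_le (fun x hx => ?_) (invdtran_nonneg z)
  exact hτ.le_invdtran hU (hx.2.trans hyz)

omit hU in
lemma dtran_invdtran_le {z : ℝ} (h : 0 < invdtran τ z) : dtran τ (invdtran τ z) ≤ z := by
  have hc : ContinuousAt (dtran τ) (invdtran τ z) :=
    (hτ.dtran_concave.continuousOn isOpen_Ioi).continuousAt (Ioi_mem_nhds h)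
  have h1 : Tendsto (dtran τ) (𝓝[<] (invdtran τ z)) (𝓝 (dtran τ (invdtran τ z))) :=
    hc.tendsto.mono_left nhdsWithin_le_nhds
  refine le_of_tendsto h1 ?_
  filter_upwards [self_mem_nhdsWithin] with x hx
  have hne : {x : ℝ | 0 < x ∧ dtran τ x ≤ z}.Nonempty := by
    by_contra hne
    rw [not_nonempty_iff_eq_empty] at hne
    rw [invdtran, hne, Real.sSup_empty] at h
    exact lt_irrefl _ h
  obtain ⟨y, hy, hxy⟩ := exists_lt_of_lt_csSup hne hx
  exact (hτ.dtran_mono hxy.le).trans hy.2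

lemma invdtran_pos {z : ℝ} (h : dtran τ 0 < z) : 0 < invdtran τ z := by
  have := hτ.tendsto_dtran_zero.eventually (gt_mem_nhds h)
  obtain ⟨x, hx, hx0⟩ := (this.and self_mem_nhdsWithin).exists
  exact lt_of_lt_of_le (show (0 : ℝ) < x from hx0) (hτ.le_invdtran hU (le_of_lt hx))

omit hU in
lemma gFun_mono : Monotone (gFun τ) := fun _ _ h =>
  ENNReal.inv_le_inv.2 (hτ.ddtran_antitone (by linarith))

lemma hFun_mono : Monotone (hFun τ) := fun _ _ h =>
  hτ.gFun_mono (hτ.invdtran_mono hU (by linarith))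

lemma hFun_lt_top (x : ℝ) : hFun τ x < ∞ := by
  rw [hFun, gFun, ENNReal.inv_lt_top, pos_iff_ne_zero]
  exact hτ.ddtran_ne_zero hU _

/-- With u = (τ')⁻¹(12z), 7u τ''(7u) ≤ τ'(7u) ≤ 7τ'(u) ≤ 84z. This turns the moment of Z² h(Z) into
integrability of Z (τ')⁻¹(12Z), the envelope of the leave-one-out differences. -/
lemma invdtran_le_mul_hFun {z : ℝ} (hz : 0 ≤ z) :
    ENNReal.ofReal (invdtran τ (12 * z)) ≤ 12 * ENNReal.ofReal z * hFun τ z := by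
  rcases eq_or_lt_of_le (invdtran_nonneg (τ := τ) (12 * z)) with h | h
  · rw [← h]; simp
  have h7 : 0 < 7 * invdtran τ (12 * z) := by linarith
  have hp := hτ.rderiv_pos hU h7
  have h1 := hτ.mul_rderiv_le h7
  have h2 := hτ.mul_dtran_le h.le (y := 7 * invdtran τ (12 * z)) (by linarith)
  have h3 := hτ.dtran_invdtran_le h
  rw [hFun, gFun, ddtran_of_pos τ h7, ← ENNReal.ofReal_inv_of_pos hp,
    show (12 : ℝ≥0∞) = ENNReal.ofReal 12 by simp, ← ENNReal.ofReal_mul (by norm_num),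
    ← ENNReal.ofReal_mul (by positivity)]
  apply ENNReal.ofReal_le_ofReal
  rw [← div_eq_mul_inv, le_div_iff₀ hp]
  set u := invdtran τ (12 * z)
  have h4 : u * dtran τ (7 * u) ≤ u * (7 * dtran τ u) := by linarith
  have h5 := le_of_mul_le_mul_left h4 h
  linarith

end Inverse

end IsTransformation

/-! ### Strong convexity in CAT(0) spaces and the sample mean. -/

section Geometry

variable {Q : Type*} [MetricSpace Q] {τ : ℝ → ℝ} {ι : Type*}

/-- The objective function of the sample mean of the points `y j`, `j ∈ J`. -/
noncomputable def sampleObj (τ : ℝ → ℝ) (J : Finset ι) (y : ι → Q) (q : Q) : ℝ :=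
  ∑ j ∈ J, τ (dist (y j) q)

/-- The square of the right side exceeds the CAT(0) bound by t(1-t)(d(x,y)² - (d(z,x) - d(z,y))²),
which is nonnegative by the reverse triangle inequality. -/
lemma IsHadamardSpace.dist_geodesic_le (hQ : IsHadamardSpace Q) {x y : Q} {γ : ℝ → Q}
    (hγ : IsGeodesic γ x y) (z : Q) {t : ℝ} (ht : t ∈ Icc (0 : ℝ) 1) :
    dist z (γ t) ≤ (1 - t) * dist z x + t * dist z y := by
  have h := hQ.cat_zero x y γ hγ z t ht
  have h1 : |dist z x - dist z y| ≤ dist x y := by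
    rw [dist_comm z x, dist_comm z y]; exact abs_dist_sub_le x y z
  have h2 : (dist z x - dist z y) ^ 2 ≤ dist x y ^ 2 := sq_le_sq' (by linarith [(abs_le.1 h1).1])
    (abs_le.1 h1).2
  have ht1 : 0 ≤ t * (1 - t) := mul_nonneg ht.1 (sub_nonneg.2 ht.2)
  have h3 := mul_le_mul_of_nonneg_left h2 ht1
  have h4 : 0 ≤ (1 - t) * dist z x + t * dist z y :=
    add_nonneg (mul_nonneg (sub_nonneg.2 ht.2) dist_nonneg) (mul_nonneg ht.1 dist_nonneg)
  refine abs_le_of_sq_le_sq' ?_ h4 |>.2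
  nlinarith

lemma IsTransformation.strongly_convex (hτ : IsTransformation τ) (hQ : IsHadamardSpace Q)
    {x y : Q} {γ : ℝ → Q} (hγ : IsGeodesic γ x y) {z : Q} {R : ℝ} (hx : dist z x ≤ R)
    (hy : dist z y ≤ R) {t : ℝ} (ht : t ∈ Icc (0 : ℝ) 1) :
    τ (dist z (γ t)) ≤ (1 - t) * τ (dist z x) + t * τ (dist z y) -
      rderiv τ R / 2 * (t * (1 - t) * dist x y ^ 2) := by
  have ht' := sub_nonneg.2 ht.2
  have hle := hQ.dist_geodesic_le hγ z ht
  have hvR : (1 - t) * dist z x + t * dist z y ≤ R := by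
    nlinarith [mul_le_mul_of_nonneg_left hx ht', mul_le_mul_of_nonneg_left hy ht.1]
  have hm := hτ.sub_sq_monotoneOn R ⟨dist_nonneg, hle.trans hvR⟩
    ⟨dist_nonneg.trans hle, hvR⟩ hle
  have hc := (hτ.sub_sq_convexOn R).2 (⟨dist_nonneg, hx⟩ : dist z x ∈ Icc 0 R)
    (⟨dist_nonneg, hy⟩ : dist z y ∈ Icc 0 R) ht' ht.1 (by ring)
  have hs := mul_le_mul_of_nonneg_right (hQ.cat_zero x y γ hγ z t ht) (hτ.rderiv_nonneg R)
  simp only [smul_eq_mul] at hm hc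
  linarith

lemma IsTransformation.convex_geodesic (hτ : IsTransformation τ) (hQ : IsHadamardSpace Q)
    {x y : Q} {γ : ℝ → Q} (hγ : IsGeodesic γ x y) (z : Q) {t : ℝ} (ht : t ∈ Icc (0 : ℝ) 1) :
    τ (dist z (γ t)) ≤ (1 - t) * τ (dist z x) + t * τ (dist z y) := by
  have h := hτ.strongly_convex hQ hγ (le_max_left (dist z x) (dist z y)) (le_max_right _ _) ht
  have := hτ.rderiv_nonneg (max (dist z x) (dist z y))
  have h2 : 0 ≤ rderiv τ (max (dist z x) (dist z y)) / 2 * (t * (1 - t) * dist x y ^ 2) :=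
    mul_nonneg (by linarith) (mul_nonneg (mul_nonneg ht.1 (sub_nonneg.2 ht.2)) (sq_nonneg _))
  linarith

/-- Compare F(q) with F at time t on the geodesic to p, divide by t and let t ↘ 0. -/
lemma mul_sq_le_of_isMin (hQ : IsHadamardSpace Q) {F : Q → ℝ} {q p : Q} {κ : ℝ}
    (h : ∀ γ : ℝ → Q, IsGeodesic γ q p → ∀ t ∈ Icc (0 : ℝ) 1,
      F (γ t) ≤ (1 - t) * F q + t * F p - κ * (t * (1 - t) * dist q p ^ 2))
    (hmin : ∀ x, F q ≤ F x) : κ * dist q p ^ 2 ≤ F p - F q := by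
  obtain ⟨γ, hγ⟩ := hQ.exists_geodesic q p
  have h1 : Tendsto (fun t : ℝ => κ * ((1 - t) * dist q p ^ 2)) (𝓝[>] 0)
      (𝓝 (κ * ((1 - 0) * dist q p ^ 2))) :=
    (Continuous.tendsto (by fun_prop) 0).mono_left nhdsWithin_le_nhds
  rw [sub_zero, one_mul] at h1
  refine le_of_tendsto h1 ?_
  filter_upwards [Ioo_mem_nhdsGT (one_pos : (0 : ℝ) < 1)] with t ht
  have h2 := h γ hγ t ⟨ht.1.le, ht.2.le⟩
  have h3 := hmin (γ t)
  have h4 : t * (κ * ((1 - t) * dist q p ^ 2)) ≤ t * (F p - F q) := by linarith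
  exact le_of_mul_le_mul_left h4 ht.1

/-- Only the points of J' have to be near; the others contribute plain convexity. This freedom keeps
outliers from spoiling the curvature. -/
lemma sampleObj_strongly_convex (hτ : IsTransformation τ) (hQ : IsHadamardSpace Q)
    {J J' : Finset ι} (hJ : J' ⊆ J) {y : ι → Q} {x z : Q} {R : ℝ}
    (hx : ∀ j ∈ J', dist (y j) x ≤ R) (hz : ∀ j ∈ J', dist (y j) z ≤ R)
    {γ : ℝ → Q} (hγ : IsGeodesic γ x z) {t : ℝ} (ht : t ∈ Icc (0 : ℝ) 1) :
    sampleObj τ J y (γ t) ≤ (1 - t) * sampleObj τ J y x + t * sampleObj τ J y z -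
      J'.card * rderiv τ R / 2 * (t * (1 - t) * dist x z ^ 2) := by
  classical
  have e : (J'.card : ℝ) * rderiv τ R / 2 * (t * (1 - t) * dist x z ^ 2) =
      ∑ j ∈ J, if j ∈ J' then rderiv τ R / 2 * (t * (1 - t) * dist x z ^ 2) else 0 := by
    rw [Finset.sum_ite_mem, Finset.inter_eq_right.2 hJ, Finset.sum_const, nsmul_eq_mul]
    ring
  rw [e]
  simp only [sampleObj, Finset.mul_sum, ← Finset.sum_add_distrib, ← Finset.sum_sub_distrib]
  refine Finset.sum_le_sum fun j _ => ?_
  split_ifs with hj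
  · exact hτ.strongly_convex hQ hγ (hx j hj) (hz j hj) ht
  · rw [sub_zero]; exact hτ.convex_geodesic hQ hγ (y j) ht

lemma sampleObj_growth (hτ : IsTransformation τ) (hQ : IsHadamardSpace Q)
    {J J' : Finset ι} (hJ : J' ⊆ J) {y : ι → Q} {q p : Q} {R : ℝ}
    (hq : ∀ j ∈ J', dist (y j) q ≤ R) (hp : ∀ j ∈ J', dist (y j) p ≤ R)
    (hmin : ∀ x, sampleObj τ J y q ≤ sampleObj τ J y x) :
    J'.card * rderiv τ R / 2 * dist q p ^ 2 ≤ sampleObj τ J y p - sampleObj τ J y q :=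
  mul_sq_le_of_isMin hQ
    (fun _ hγ _ ht => sampleObj_strongly_convex hτ hQ hJ hq hp hγ ht) hmin

lemma continuous_tau_dist (hτ : IsTransformation τ) {X : Type*} [TopologicalSpace X]
    {f g : X → Q} (hf : Continuous f) (hg : Continuous g) :
    Continuous fun x => τ (dist (f x) (g x)) :=
  hτ.continuousOn.comp_continuous (hf.dist hg) fun _ => dist_nonneg

lemma sampleObj_nonneg (hτ : IsTransformation τ) (J : Finset ι) (y : ι → Q) (q : Q) :
    0 ≤ sampleObj τ J y q :=
  Finset.sum_nonneg fun _ _ => hτ.nonneg dist_nonneg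

lemma dist_le_of_sampleObj_le (hτ : IsTransformation τ) {J : Finset ι} {j : ι} (hj : j ∈ J)
    {y : ι → Q} {q : Q} {B : ℝ} (h : sampleObj τ J y q ≤ B) :
    dist (y j) q ≤ 1 + 2 * B / dtran τ 1 := by
  have h1 : τ (dist (y j) q) ≤ B := le_trans
    (Finset.single_le_sum (f := fun j => τ (dist (y j) q))
      (fun _ _ => hτ.nonneg dist_nonneg) hj) h
  have hB : 0 ≤ B := (hτ.nonneg dist_nonneg).trans h1
  have hp := hτ.dtran_pos one_pos
  rcases le_or_gt (dist (y j) q) 1 with h2 | h2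
  · have : 0 ≤ 2 * B / dtran τ 1 := by positivity
    linarith
  · have h3 := hτ.half_mul_dtran_le (x := dist (y j) q) dist_nonneg
    have h4 := mul_le_mul_of_nonneg_left (hτ.dtran_mono h2.le) (dist_nonneg (x := y j) (y := q))
    have : dist (y j) q ≤ 2 * B / dtran τ 1 := by
      rw [le_div_iff₀ hp]; linarith
    linarith

/-- Bounded sets need not be compact, so a minimizing sequence is shown to be Cauchy by strong
convexity at midpoints; a single data point supplies enough curvature. -/
lemma exists_sampleObj_min (hτ : IsTransformation τ) (hQ : IsHadamardSpace Q)
    (hU : ∀ B, ∃ x, 0 < x ∧ B < dtran τ x) {J : Finset ι} (hJ : J.Nonempty) (y : ι → Q) :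
    ∃ q, ∀ x, sampleObj τ J y q ≤ sampleObj τ J y x := by
  have := hQ.nonempty
  have := hQ.complete
  obtain ⟨j, hj⟩ := hJ
  set F := sampleObj τ J y with hF
  have hbdd : BddBelow (range F) := ⟨0, by rintro _ ⟨q, rfl⟩; exact sampleObj_nonneg hτ J y q⟩
  set I := ⨅ q, F q with hI
  have hIle : ∀ q, I ≤ F q := fun q => ciInf_le hbdd q
  have hI0 : 0 ≤ I := Real.iInf_nonneg fun q => sampleObj_nonneg hτ J y q
  have hex : ∀ k : ℕ, ∃ q, F q < I + 1 / ((k : ℝ) + 1) := fun k =>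
    exists_lt_of_ciInf_lt (lt_add_of_pos_right I (by positivity))
  choose u hu using hex
  set R := 1 + 2 * (I + 1) / dtran τ 1 with hR
  have hp := hτ.dtran_pos one_pos
  have hR0 : 0 < R := by positivity
  have hκ := hτ.rderiv_pos hU hR0
  have hone : ∀ k : ℕ, 1 / ((k : ℝ) + 1) ≤ 1 := fun k => by
    rw [div_le_one (by positivity)]; linarith [Nat.cast_nonneg (α := ℝ) k]
  have hd : ∀ k, dist (y j) (u k) ≤ R := fun k =>
    dist_le_of_sampleObj_le hτ hj ((hu k).le.trans (by linarith [hone k]))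
  have hcau : CauchySeq u := by
    refine cauchySeq_of_le_tendsto_0
      -- At the midpoint the convexity gain is (κ/2)(1/4) d², whence the 8.
      (fun N : ℕ => √(8 / rderiv τ R * (1 / ((N : ℝ) + 1)))) ?_ ?_
    · intro k l N hk hl
      apply Real.le_sqrt_of_sq_le
      obtain ⟨γ, hγ⟩ := hQ.exists_geodesic (u k) (u l)
      have h1 := sampleObj_strongly_convex hτ hQ (J := J) (J' := {j}) (y := y) (R := R)
        (by simpa using hj) (by simpa using hd k) (by simpa using hd l) hγ
        (t := 1 / 2) (by constructor <;> norm_num)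
      have h2 := hIle (γ (1 / 2))
      have hmono : ∀ k : ℕ, N ≤ k → 1 / ((k : ℝ) + 1) ≤ 1 / ((N : ℝ) + 1) := fun k hk =>
        one_div_le_one_div_of_le (by positivity) (by exact_mod_cast Nat.succ_le_succ hk)
      have h3 := hu k
      have h4 := hu l
      have h5 := hmono k hk
      have h6 := hmono l hl
      rw [← hF] at h1
      simp only [Finset.card_singleton, Nat.cast_one] at h1
      rw [div_mul_eq_mul_div, le_div_iff₀ hκ]
      nlinarith
    · have : Tendsto (fun N : ℕ => 8 / rderiv τ R * (1 / ((N : ℝ) + 1))) atTop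
          (𝓝 (8 / rderiv τ R * 0)) := tendsto_one_div_add_atTop_nhds_zero_nat.const_mul _
      simpa using this.sqrt
  obtain ⟨q, hq⟩ := cauchySeq_tendsto_of_complete hcau
  refine ⟨q, fun x => le_trans ?_ (hIle x)⟩
  have hcont : Continuous F := continuous_finsetSum _ fun j _ =>
    continuous_tau_dist hτ continuous_const continuous_id
  have h1 : Tendsto (fun k : ℕ => I + 1 / ((k : ℝ) + 1)) atTop (𝓝 (I + 0)) :=
    tendsto_one_div_add_atTop_nhds_zero_nat.const_add _
  rw [add_zero] at h1
  exact le_of_tendsto_of_tendsto' ((hcont.tendsto q).comp hq) h1 fun k => (hu k).le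

lemma sampleObj_min_unique (hτ : IsTransformation τ) (hQ : IsHadamardSpace Q)
    (hU : ∀ B, ∃ x, 0 < x ∧ B < dtran τ x) {J : Finset ι} (hJ : J.Nonempty) {y : ι → Q}
    {q p : Q} (hq : ∀ x, sampleObj τ J y q ≤ sampleObj τ J y x)
    (hp : ∀ x, sampleObj τ J y p ≤ sampleObj τ J y x) : q = p := by
  obtain ⟨j, hj⟩ := hJ
  set R := dist (y j) q + dist (y j) p + 1 with hR
  have hR0 : 0 < R := by positivity
  have h := sampleObj_growth hτ hQ (J := J) (J' := {j}) (y := y) (R := R) (p := p)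
    (by simpa using hj)
    (by simp only [Finset.mem_singleton, forall_eq]; linarith [dist_nonneg (x := y j) (y := p)])
    (by simp only [Finset.mem_singleton, forall_eq]; linarith [dist_nonneg (x := y j) (y := q)])
    hq
  have hκ := hτ.rderiv_pos hU hR0
  simp only [Finset.card_singleton, Nat.cast_one] at h
  have h2 : rderiv τ R / 2 * dist q p ^ 2 ≤ rderiv τ R / 2 * 0 := by
    linarith [hp q]
  have h3 := le_of_mul_le_mul_left h2 (by linarith)
  have h4 : dist q p ^ 2 = 0 := le_antisymm h3 (sq_nonneg _)
  exact dist_eq_zero.1 (pow_eq_zero_iff two_ne_zero |>.1 h4)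

/-- A deterministic location bound for a minimizer q and any reference m. With D = d(q,m), summing
`add_sub_le` and using minimality gives |J| τ(D) ≤ 2D ∑ τ'(d(y_j,m)), and τ(D) ≥ D τ'(D)/2 allows
division by D. -/
lemma card_mul_dtran_le (hτ : IsTransformation τ) {J : Finset ι} {y : ι → Q} {q : Q} (m : Q)
    (hq : ∀ x, sampleObj τ J y q ≤ sampleObj τ J y x) :
    J.card * dtran τ (dist q m) ≤ 4 * ∑ j ∈ J, dtran τ (dist (y j) m) := by
  rcases eq_or_lt_of_le (dist_nonneg (x := q) (y := m)) with h0 | h0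
  · rw [← h0, ← nsmul_eq_mul, ← Finset.sum_const, Finset.mul_sum]
    refine Finset.sum_le_sum fun j _ => ?_
    have := hτ.dtran_mono (dist_nonneg (x := y j) (y := m))
    linarith [hτ.dtran_nonneg (dist (y j) m)]
  have h1 : ∑ j ∈ J, (τ (dist q m) + τ (dist (y j) m) - τ (dist (y j) q)) ≤
      ∑ j ∈ J, 2 * dist q m * dtran τ (dist (y j) m) :=
    Finset.sum_le_sum fun j _ => hτ.add_sub_le dist_nonneg dist_nonneg (by
      rw [dist_comm (y j) q, dist_comm q m, dist_comm (y j) m]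
      have := abs_dist_sub_le q (y j) m
      rwa [dist_comm q m, dist_comm (y j) m] at this)
  rw [Finset.sum_sub_distrib, Finset.sum_add_distrib, Finset.sum_const, nsmul_eq_mul,
    ← Finset.mul_sum] at h1
  have h2 := hq m
  have h3 := mul_le_mul_of_nonneg_left (hτ.half_mul_dtran_le h0.le) (Nat.cast_nonneg (α := ℝ) J.card)
  simp only [sampleObj] at h2
  have h4 : dist q m * (J.card * dtran τ (dist q m)) ≤
      dist q m * (4 * ∑ j ∈ J, dtran τ (dist (y j) m)) := by linarith
  exact le_of_mul_le_mul_left h4 h0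

/-- A minimizer of the objective function of the points `y j`, `j ∈ J`, if there is one. -/
noncomputable def sampleMean [Nonempty Q] (τ : ℝ → ℝ) (J : Finset ι) (y : ι → Q) : Q :=
  Classical.epsilon fun q => ∀ x, sampleObj τ J y q ≤ sampleObj τ J y x

lemma sampleMean_spec [Nonempty Q] (hτ : IsTransformation τ) (hQ : IsHadamardSpace Q)
    (hU : ∀ B, ∃ x, 0 < x ∧ B < dtran τ x) {J : Finset ι} (hJ : J.Nonempty) (y : ι → Q) (x : Q) :
    sampleObj τ J y (sampleMean τ J y) ≤ sampleObj τ J y x :=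
  Classical.epsilon_spec (exists_sampleObj_min hτ hQ hU hJ y) x

/-- Continuity serves as the source of measurability. Quadratic growth at the old minimizer and a
Lipschitz estimate for the objective in the data give a local Hölder bound of order 1/2. -/
lemma continuous_sampleMean [Nonempty Q] [Fintype ι] (hτ : IsTransformation τ)
    (hQ : IsHadamardSpace Q) (hU : ∀ B, ∃ x, 0 < x ∧ B < dtran τ x) {J : Finset ι}
    (hJ : J.Nonempty) : Continuous fun y : ι → Q => sampleMean τ J y := by
  rw [continuous_iff_continuousAt]
  intro y
  set q := sampleMean τ J y with hq
  set B := 4 * ∑ j ∈ J, dtran τ (dist (y j) q + 1) with hB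
  -- R bounds all distances between old or new data and old or new mean: the new mean is within
  -- (τ')⁻¹(B) of q, and the data move by less than 1.
  set R := ∑ j ∈ J, dist (y j) q + invdtran τ B + 1 with hR
  have hs0 : 0 ≤ ∑ j ∈ J, dist (y j) q := Finset.sum_nonneg fun _ _ => dist_nonneg
  have hR0 : 0 < R := by linarith [invdtran_nonneg (τ := τ) B]
  have hκ := hτ.rderiv_pos hU hR0
  have hR1 := hτ.dtran_pos hR0
  have key : ∀ y' : ι → Q, dist y' y < 1 → dist (sampleMean τ J y') q ≤
      √(4 * dtran τ R / rderiv τ R * ∑ j ∈ J, dist (y' j) (y j)) := by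
    intro y' hy'
    have hy'j : ∀ j, dist (y' j) (y j) < 1 := fun j => (dist_le_pi_dist y' y j).trans_lt hy'
    set q' := sampleMean τ J y' with hq'
    have hmin := sampleMean_spec hτ hQ hU hJ y
    have hmin' := sampleMean_spec hτ hQ hU hJ y'
    rw [← hq] at hmin
    rw [← hq'] at hmin'
    have hloc := card_mul_dtran_le hτ q hmin'
    have hcard : (1 : ℝ) ≤ J.card := by exact_mod_cast hJ.card_pos
    have hqq : dist q' q ≤ invdtran τ B := by
      apply hτ.le_invdtran hU
      have h1 : 4 * ∑ j ∈ J, dtran τ (dist (y' j) q) ≤ B :=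
        mul_le_mul_of_nonneg_left (Finset.sum_le_sum fun j _ => hτ.dtran_mono (by
          linarith [dist_triangle (y' j) (y j) q, hy'j j])) (by norm_num)
      have h2 := mul_le_mul_of_nonneg_right hcard (hτ.dtran_nonneg (dist q' q))
      linarith
    have hyq : ∀ j ∈ J, dist (y j) q ≤ ∑ j ∈ J, dist (y j) q := fun j hj =>
      Finset.single_le_sum (f := fun j => dist (y j) q) (fun _ _ => dist_nonneg) hj
    have hinv := invdtran_nonneg (τ := τ) B
    have b1 : ∀ j ∈ J, dist (y j) q ≤ R := fun j hj => by linarith [hyq j hj]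
    have b2 : ∀ j ∈ J, dist (y' j) q ≤ R := fun j hj => by
      linarith [hyq j hj, dist_triangle (y' j) (y j) q, hy'j j]
    have b3 : ∀ j ∈ J, dist (y j) q' ≤ R := fun j hj => by
      linarith [hyq j hj, dist_triangle (y j) q q', dist_comm q q']
    have b4 : ∀ j ∈ J, dist (y' j) q' ≤ R := fun j hj => by
      linarith [hyq j hj, dist_triangle4 (y' j) (y j) q q', dist_comm q q', hy'j j]
    have hg := sampleObj_growth hτ hQ (Finset.Subset.refl J) b1 b3 hmin
    have hdiff : ∀ (r : Q) (j : ι), dist (y j) r ≤ R → dist (y' j) r ≤ R →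
        |τ (dist (y j) r) - τ (dist (y' j) r)| ≤ dist (y' j) (y j) * dtran τ R := by
      intro r j h1 h2
      refine (hτ.abs_sub_le dist_nonneg dist_nonneg h1 h2).trans ?_
      refine mul_le_mul_of_nonneg_right ?_ hR1.le
      rw [dist_comm (y' j) (y j)]
      exact abs_dist_sub_le (y j) (y' j) r
    have h1 : sampleObj τ J y q' - sampleObj τ J y' q' ≤
        (∑ j ∈ J, dist (y' j) (y j)) * dtran τ R := by
      rw [sampleObj, sampleObj, ← Finset.sum_sub_distrib, Finset.sum_mul]
      exact Finset.sum_le_sum fun j hj =>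
        (le_abs_self _).trans (hdiff q' j (b3 j hj) (b4 j hj))
    have h2 : sampleObj τ J y' q - sampleObj τ J y q ≤
        (∑ j ∈ J, dist (y' j) (y j)) * dtran τ R := by
      rw [sampleObj, sampleObj, ← Finset.sum_sub_distrib, Finset.sum_mul]
      refine Finset.sum_le_sum fun j hj => le_trans ?_ (hdiff q j (b1 j hj) (b2 j hj))
      rw [abs_sub_comm]
      exact le_abs_self _
    have h3 := hmin' q
    apply Real.le_sqrt_of_sq_le
    rw [dist_comm, div_mul_eq_mul_div, le_div_iff₀ hκ]
    have h4 := mul_le_mul_of_nonneg_right hcard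
      (mul_nonneg hκ.le (sq_nonneg (dist q q')))
    linarith
  rw [ContinuousAt, tendsto_iff_dist_tendsto_zero]
  have hc : Continuous fun y' : ι → Q =>
      √(4 * dtran τ R / rderiv τ R * ∑ j ∈ J, dist (y' j) (y j)) := by fun_prop
  have hc0 := hc.tendsto y
  simp only [dist_self, Finset.sum_const_zero, mul_zero, Real.sqrt_zero] at hc0
  refine squeeze_zero' (Eventually.of_forall fun _ => dist_nonneg) ?_ hc0
  filter_upwards [Metric.ball_mem_nhds y one_pos] with y' hy' using key y' hy'

end Geometry

/-! ### Stability of the sample mean under removal of a point. -/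

section LeaveOneOut

/-- The reciprocal of `τ''` at `2 (τ')⁻¹(6 x)`. -/
noncomputable def invCurv (τ : ℝ → ℝ) (x : ℝ) : ℝ≥0∞ := (ddtran τ (2 * invdtran τ (6 * x)))⁻¹

variable {Q : Type*} [MetricSpace Q] {τ : ℝ → ℝ}

lemma IsTransformation.invCurv_mono (hτ : IsTransformation τ)
    (hU : ∀ B, ∃ x, 0 < x ∧ B < dtran τ x) : Monotone (invCurv τ) := fun x y h =>
  ENNReal.inv_le_inv.2 (hτ.ddtran_antitone (by
    have := hτ.invdtran_mono hU (show 6 * x ≤ 6 * y by linarith)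
    linarith))

/-- The constants 7 and 12 in g and h dominate the 2 and 6 that the stability argument produces. -/
lemma IsTransformation.invCurv_le_hFun (hτ : IsTransformation τ)
    (hU : ∀ B, ∃ x, 0 < x ∧ B < dtran τ x) {x y : ℝ} (h : x ≤ 2 * y) :
    invCurv τ x ≤ hFun τ y :=
  ENNReal.inv_le_inv.2 (hτ.ddtran_antitone (by
    have := hτ.invdtran_mono hU (show 6 * x ≤ 12 * y by linarith)
    linarith [invdtran_nonneg (τ := τ) (12 * y)]))

/-- At least five sixths of `n` nonnegative numbers are at most `6 s`, if their sum is at most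
`n s` and `s > 0`. -/
lemma five_mul_card_le {ι : Type*} (J : Finset ι) {a : ι → ℝ} (ha : ∀ j, 0 ≤ a j) {s : ℝ}
    (hs : 0 < s) (hsum : ∑ j ∈ J, a j ≤ J.card * s) :
    5 * (J.card : ℝ) ≤ 6 * (J.filter fun j => a j ≤ 6 * s).card := by
  have h1 := J.card_filter_add_card_filter_not (fun j => a j ≤ 6 * s)
  have h2 : ((J.filter fun j => ¬ a j ≤ 6 * s).card : ℝ) * (6 * s) ≤ J.card * s := by
    refine le_trans ?_ hsum
    rw [← nsmul_eq_mul, ← Finset.sum_const]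
    refine (Finset.sum_le_sum fun j hj => ?_).trans
      (Finset.sum_le_sum_of_subset_of_nonneg (Finset.filter_subset _ J) fun j _ _ => ha j)
    exact (not_le.1 (Finset.mem_filter.1 hj).2).le
  have h3 : ((J.filter fun j => ¬ a j ≤ 6 * s).card : ℝ) * 6 ≤ J.card :=
    le_of_mul_le_mul_right (by linarith) hs
  have h4 : ((J.filter fun j => a j ≤ 6 * s).card : ℝ) +
      (J.filter fun j => ¬ a j ≤ 6 * s).card = J.card := by exact_mod_cast h1
  linarith

variable [Nonempty Q]

/-- Let d = d(q,p), κ = τ''(R), and A = τ'(d(y_i,q)). Growth at both minimizers gives 5nκd² ≤ 6Δ,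
and Δ ≤ dA by the mean value theorem; hence 5nκΔ ≤ 6A². Finally A is bounded through
`card_mul_dtran_le`. -/
lemma leaveOneOut_diff_le (hτ : IsTransformation τ) (hQ : IsHadamardSpace Q)
    (hU : ∀ B, ∃ x, 0 < x ∧ B < dtran τ x) {n : ℕ} (hn : 1 ≤ n) (y : Fin (n + 1) → Q) (m : Q)
    {s : ℝ} (hs : 0 < s) (hsum : ∑ j, dtran τ (dist (y j) m) ≤ n * s) (i : Fin (n + 1)) :
    n * rderiv τ (2 * invdtran τ (6 * s)) *
      (τ (dist (y i) (sampleMean τ (Finset.univ.erase i) y)) -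
        τ (dist (y i) (sampleMean τ Finset.univ y))) ≤
      6 * dtran τ (dist (y i) m) ^ 2 +
        24 / n * ∑ j ∈ Finset.univ.erase i, dtran τ (dist (y j) m) ^ 2 := by
  have hn0 : (0 : ℝ) < n := by exact_mod_cast hn
  set J := (Finset.univ : Finset (Fin (n + 1))).erase i with hJ
  have hJcard : J.card = n := by simp [hJ]
  have hJne : J.Nonempty := Finset.card_pos.1 (by omega)
  set q := sampleMean τ J y with hq
  set p := sampleMean τ Finset.univ y with hp
  have hqmin := sampleMean_spec hτ hQ hU hJne y
  have hpmin := sampleMean_spec hτ hQ hU Finset.univ_nonempty y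
  rw [← hq] at hqmin
  rw [← hp] at hpmin
  set a : Fin (n + 1) → ℝ := fun j => dtran τ (dist (y j) m) with ha
  have ha0 : ∀ j, 0 ≤ a j := fun j => hτ.dtran_nonneg _
  have hsplit : ∀ f : Fin (n + 1) → ℝ, ∑ j, f j = f i + ∑ j ∈ J, f j := fun f =>
    (Finset.add_sum_erase _ f (Finset.mem_univ i)).symm
  have hsumJ : ∑ j ∈ J, a j ≤ J.card * s := by
    rw [hJcard]; linarith [hsplit a, ha0 i]
  set R := 2 * invdtran τ (6 * s) with hR
  have hinv : invdtran τ (4 * s) ≤ invdtran τ (6 * s) := hτ.invdtran_mono hU (by linarith)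
  have hτ0 : dtran τ 0 < 6 * s := by
    have h1 : J.card * dtran τ 0 ≤ ∑ j ∈ J, a j := by
      rw [← nsmul_eq_mul, ← Finset.sum_const]
      exact Finset.sum_le_sum fun j _ => hτ.dtran_mono dist_nonneg
    have := le_of_mul_le_mul_left (h1.trans hsumJ) (by rw [hJcard]; exact hn0)
    linarith
  have hR0 : 0 < R := by linarith [hτ.invdtran_pos hU hτ0]
  have hκ := hτ.rderiv_pos hU hR0
  have hqm : dist q m ≤ invdtran τ (4 * s) := by
    apply hτ.le_invdtran hU
    have h1 := card_mul_dtran_le hτ m hqmin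
    have h2 : (n : ℝ) * dtran τ (dist q m) ≤ n * (4 * s) := by
      rw [hJcard] at h1 hsumJ; linarith
    exact le_of_mul_le_mul_left h2 hn0
  have hpm : dist p m ≤ invdtran τ (4 * s) := by
    apply hτ.le_invdtran hU
    have h1 := card_mul_dtran_le hτ m hpmin
    rw [Finset.card_fin, Nat.cast_add, Nat.cast_one] at h1
    have h2 : (n : ℝ) * dtran τ (dist p m) ≤ n * (4 * s) := by
      linarith [hτ.dtran_nonneg (dist p m)]
    exact le_of_mul_le_mul_left h2 hn0
  -- These points are within (τ')⁻¹(6s) of m, and both means are within (τ')⁻¹(4s), so R bounds the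
  -- distances between them.
  set J' := J.filter fun j => a j ≤ 6 * s with hJ'
  have hcard := five_mul_card_le J ha0 hs hsumJ
  rw [← hJ', hJcard] at hcard
  have hdist : ∀ r : Q, dist r m ≤ invdtran τ (4 * s) → ∀ j ∈ J', dist (y j) r ≤ R := by
    intro r hr j hj
    have := hτ.le_invdtran hU (Finset.mem_filter.1 hj).2
    linarith [dist_triangle_right (y j) r m]
  have hJJ : J' ⊆ J := Finset.filter_subset _ _
  have g1 := sampleObj_growth hτ hQ hJJ (hdist q hqm) (hdist p hpm) hqmin
  have g2 := sampleObj_growth hτ hQ (hJJ.trans (Finset.subset_univ J)) (hdist p hpm)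
    (hdist q hqm) hpmin
  have eobj : ∀ r, sampleObj τ Finset.univ y r = τ (dist (y i) r) + sampleObj τ J y r :=
    fun r => hsplit fun j => τ (dist (y j) r)
  rw [eobj, eobj, dist_comm p q] at g2
  set Δ := τ (dist (y i) q) - τ (dist (y i) p) with hΔ
  set d := dist q p with hd
  have hd0 : 0 ≤ d := dist_nonneg
  have hlow : 5 * (n * rderiv τ R) * d ^ 2 ≤ 6 * Δ := by
    have := mul_le_mul_of_nonneg_right hcard (mul_nonneg hκ.le (sq_nonneg d))
    linarith
  set A := dtran τ (dist (y i) q) with hA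
  have hA0 : 0 ≤ A := hτ.dtran_nonneg _
  have hup : Δ ≤ d * A := by
    rcases le_total (dist (y i) q) (dist (y i) p) with h | h
    · have := hτ.monotone dist_nonneg dist_nonneg h
      have h2 := mul_nonneg hd0 hA0
      linarith
    · refine (hτ.sub_le dist_nonneg h).trans (mul_le_mul_of_nonneg_right ?_ hA0)
      linarith [dist_triangle_right (y i) q p, dist_triangle (y i) p q, dist_comm p q]
  have hnK : 0 < n * rderiv τ R := mul_pos hn0 hκ
  have hΔA : 5 * (n * rderiv τ R) * Δ ≤ 6 * A ^ 2 := by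
    rcases eq_or_lt_of_le hd0 with h | h
    · rw [← h] at hup
      have h1 : Δ ≤ 0 := by linarith
      have h2 := mul_nonneg hnK.le (neg_nonneg.2 h1)
      linarith [sq_nonneg A]
    · have h1 : d * (5 * (n * rderiv τ R) * d) ≤ d * (6 * A) := by
        linarith
      have h2 := le_of_mul_le_mul_left h1 h
      have h3 := mul_le_mul_of_nonneg_right h2 hA0
      have h4 := mul_le_mul_of_nonneg_left hup hnK.le
      linarith
  have hAle : n * A ≤ n * a i + 4 * ∑ j ∈ J, a j := by
    have h1 : A ≤ a i + dtran τ (dist q m) :=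
      (hτ.dtran_mono (dist_triangle_right (y i) q m)).trans
        (hτ.dtran_add_le dist_nonneg dist_nonneg)
    have h2 := card_mul_dtran_le hτ m hqmin
    rw [hJcard] at h2
    have := mul_le_mul_of_nonneg_left h1 hn0.le
    linarith
  have hCS : (∑ j ∈ J, a j) ^ 2 ≤ n * ∑ j ∈ J, a j ^ 2 := by
    have := sq_sum_le_card_mul_sum_sq (s := J) (f := a)
    rwa [hJcard] at this
  set T := ∑ j ∈ J, a j with hT
  set T2 := ∑ j ∈ J, a j ^ 2 with hT2
  have hT0 : 0 ≤ T := Finset.sum_nonneg fun j _ => ha0 j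
  have hAsq : (n * A) ^ 2 ≤ (n * a i + 4 * T) ^ 2 :=
    pow_le_pow_left₀ (mul_nonneg hn0.le hA0) hAle 2
  -- The gap is 4(n a_i - T)².
  have h5 : (n * a i + 4 * T) ^ 2 ≤ 5 * (n * a i) ^ 2 + 20 * T ^ 2 := by
    nlinarith [sq_nonneg (n * a i - T)]
  have h6 : (n : ℝ) * (n * A ^ 2) ≤ n * (5 * n * a i ^ 2 + 20 * T2) := by linarith
  have h7 := le_of_mul_le_mul_left h6 hn0
  have h8 : A ^ 2 ≤ 5 * a i ^ 2 + 20 / n * T2 := by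
    have e : (5 * a i ^ 2 + 20 / n * T2) = (5 * n * a i ^ 2 + 20 * T2) / n := by field_simp
    rw [e, le_div_iff₀ hn0]
    linarith
  have e : 24 / (n : ℝ) * T2 = 6 / 5 * (20 / n * T2) := by ring
  rw [e]
  linarith

lemma leaveOneOut_sum_le (hτ : IsTransformation τ) (hQ : IsHadamardSpace Q)
    (hU : ∀ B, ∃ x, 0 < x ∧ B < dtran τ x) {n : ℕ} (hn : 1 ≤ n) (y : Fin (n + 1) → Q) (m : Q) :
    ENNReal.ofReal (∑ i, (τ (dist (y i) (sampleMean τ (Finset.univ.erase i) y)) -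
      τ (dist (y i) m))) ≤
    30 / n * (∑ i, ENNReal.ofReal (dtran τ (dist (y i) m) ^ 2)) *
      invCurv τ (1 / n * ∑ i, dtran τ (dist (y i) m)) := by
  have hn0 : (0 : ℝ) < n := by exact_mod_cast hn
  have ha0 : ∀ j, 0 ≤ dtran τ (dist (y j) m) := fun j => hτ.dtran_nonneg _
  set s := 1 / (n : ℝ) * ∑ i, dtran τ (dist (y i) m) with hs
  have hs0 : 0 ≤ s := mul_nonneg (by positivity) (Finset.sum_nonneg fun j _ => ha0 j)
  have hns : ∑ i, dtran τ (dist (y i) m) = n * s := by rw [hs]; field_simp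
  have hpmin := sampleMean_spec hτ hQ hU Finset.univ_nonempty y m
  simp only [sampleObj] at hpmin
  rcases eq_or_lt_of_le hs0 with h | h
  -- If s = 0, the radius 2(τ')⁻¹(6s) may be 0, where no real curvature is available. But then all
  -- points coincide with m, and so do the leave-one-out means.
  · have hz : ∀ i, y i = m := by
      rw [← h, mul_zero, Finset.sum_eq_zero_iff_of_nonneg fun j _ => ha0 j] at hns
      intro i
      by_contra hne
      exact (hτ.dtran_pos (dist_pos.2 hne)).ne' (hns i (Finset.mem_univ i))
    have hle : ∑ i, (τ (dist (y i) (sampleMean τ (Finset.univ.erase i) y)) -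
        τ (dist (y i) m)) ≤ 0 := by
      refine Finset.sum_nonpos fun i _ => ?_
      have hne : ((Finset.univ : Finset (Fin (n + 1))).erase i).Nonempty :=
        Finset.card_pos.1 (by simp; omega)
      obtain ⟨j, hj⟩ := hne
      have h1 := sampleMean_spec hτ hQ hU ⟨j, hj⟩ y m
      have h2 : sampleObj τ (Finset.univ.erase i) y m = 0 :=
        Finset.sum_eq_zero fun k _ => by rw [hz k, dist_self, hτ.map_zero]
      have h3 : τ (dist (y j) (sampleMean τ (Finset.univ.erase i) y)) ≤ 0 := by
        rw [← h2]
        exact le_trans (Finset.single_le_sum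
          (f := fun k => τ (dist (y k) (sampleMean τ (Finset.univ.erase i) y)))
          (fun _ _ => hτ.nonneg dist_nonneg) hj) h1
      rw [hz j] at h3
      rw [hz i, dist_self, hτ.map_zero]
      linarith
    rw [ENNReal.ofReal_of_nonpos hle]
    exact zero_le
  · have hτ0 : dtran τ 0 < 6 * s := by
      have h1 : (n : ℝ) * dtran τ 0 ≤ n * s := by
        rw [← hns]
        have : (n + 1 : ℝ) * dtran τ 0 ≤ ∑ i, dtran τ (dist (y i) m) := by
          have e : (n + 1 : ℝ) * dtran τ 0 = ∑ _i : Fin (n + 1), dtran τ 0 := by simp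
          rw [e]
          exact Finset.sum_le_sum fun j _ => hτ.dtran_mono dist_nonneg
        linarith [hτ.dtran_zero_nonneg]
      have := le_of_mul_le_mul_left h1 hn0
      linarith
    have hR0 : 0 < 2 * invdtran τ (6 * s) := by linarith [hτ.invdtran_pos hU hτ0]
    have hκ := hτ.rderiv_pos hU hR0
    have hi := fun i => leaveOneOut_diff_le hτ hQ hU hn y m h hns.le i
    set κ := rderiv τ (2 * invdtran τ (6 * s)) with hκd
    set S := ∑ i, dtran τ (dist (y i) m) ^ 2 with hS
    have hsum : n * κ * ∑ i, (τ (dist (y i) (sampleMean τ (Finset.univ.erase i) y)) -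
        τ (dist (y i) (sampleMean τ Finset.univ y))) ≤ 30 * S := by
      rw [Finset.mul_sum]
      refine (Finset.sum_le_sum fun i _ => hi i).trans ?_
      have e : ∀ i, ∑ j ∈ Finset.univ.erase i, dtran τ (dist (y j) m) ^ 2 =
          S - dtran τ (dist (y i) m) ^ 2 := fun i => by
        rw [hS, ← Finset.add_sum_erase _ _ (Finset.mem_univ i)]; ring
      simp only [e]
      rw [Finset.sum_add_distrib, ← Finset.mul_sum, ← Finset.mul_sum, Finset.sum_sub_distrib,
        ← hS, Finset.sum_const, Finset.card_fin, nsmul_eq_mul]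
      push_cast
      have : 24 / (n : ℝ) * ((n + 1) * S - S) = 24 * S := by field_simp; ring
      linarith
    rw [invCurv, ddtran_of_pos τ hR0, ← hκd, ← ENNReal.ofReal_inv_of_pos hκ,
      ← ENNReal.ofReal_sum_of_nonneg fun i _ => sq_nonneg _, ← hS,
      show (30 / n : ℝ≥0∞) = ENNReal.ofReal (30 / n) by
        rw [ENNReal.ofReal_div_of_pos hn0]; simp,
      ← ENNReal.ofReal_mul (by positivity), ← ENNReal.ofReal_mul
        (mul_nonneg (by positivity) (Finset.sum_nonneg fun _ _ => sq_nonneg _))]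
    apply ENNReal.ofReal_le_ofReal
    have e : 30 / (n : ℝ) * S * κ⁻¹ = 30 * S / (n * κ) := by field_simp
    rw [e, le_div_iff₀ (by positivity)]
    refine le_trans ?_ hsum
    rw [mul_comm]
    refine mul_le_mul_of_nonneg_left ?_ (by positivity)
    rw [Finset.sum_sub_distrib, Finset.sum_sub_distrib]
    linarith

/-- An integrable envelope that is a sum over single points. The point with the largest τ'(d(y_j,m))
= b controls everything: d(q,m) ≤ (τ')⁻¹(12b), and τ' at d(y_i,m) + d(q,m) is at most 5b. -/
lemma abs_leaveOneOut_sub_le (hτ : IsTransformation τ) (hQ : IsHadamardSpace Q)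
    (hU : ∀ B, ∃ x, 0 < x ∧ B < dtran τ x) {n : ℕ} (hn : 1 ≤ n) (y : Fin (n + 1) → Q) (m : Q)
    (i : Fin (n + 1)) :
    |τ (dist (y i) (sampleMean τ (Finset.univ.erase i) y)) - τ (dist (y i) m)| ≤
      9 * ∑ j, dtran τ (dist (y j) m) * invdtran τ (12 * dtran τ (dist (y j) m)) := by
  have hn0 : (1 : ℝ) ≤ n := by exact_mod_cast hn
  have ha0 : ∀ j, 0 ≤ dtran τ (dist (y j) m) := fun j => hτ.dtran_nonneg _
  obtain ⟨k, -, hk⟩ := Finset.exists_max_image Finset.univ (fun j => dtran τ (dist (y j) m))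
    Finset.univ_nonempty
  have hJcard : ((Finset.univ : Finset (Fin (n + 1))).erase i).card = n := by simp
  have hmin := sampleMean_spec hτ hQ hU (J := Finset.univ.erase i)
    (Finset.card_pos.1 (by omega)) y
  set q := sampleMean τ (Finset.univ.erase i) y
  set b := dtran τ (dist (y k) m) with hb
  have hD : dtran τ (dist q m) ≤ 4 * b := by
    have h1 := card_mul_dtran_le hτ m hmin
    rw [hJcard] at h1
    have h2 : ∑ j ∈ Finset.univ.erase i, dtran τ (dist (y j) m) ≤ n * b := by
      have h := Finset.sum_le_card_nsmul (Finset.univ.erase i)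
        (fun j => dtran τ (dist (y j) m)) b fun j _ => hk j (Finset.mem_univ j)
      rwa [hJcard, nsmul_eq_mul] at h
    have h3 : (n : ℝ) * dtran τ (dist q m) ≤ n * (4 * b) := by linarith
    exact le_of_mul_le_mul_left h3 (by linarith)
  have hD2 : dist q m ≤ invdtran τ (12 * b) := hτ.le_invdtran hU (by linarith [ha0 k])
  have hbound : b * invdtran τ (12 * b) ≤
      ∑ j, dtran τ (dist (y j) m) * invdtran τ (12 * dtran τ (dist (y j) m)) :=
    Finset.single_le_sum
      (f := fun j => dtran τ (dist (y j) m) * invdtran τ (12 * dtran τ (dist (y j) m)))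
      (fun j _ => mul_nonneg (ha0 j) (invdtran_nonneg _)) (Finset.mem_univ k)
  have h1 := hτ.abs_sub_le (x := dist (y i) q) (y := dist (y i) m) (R := dist (y i) m + dist q m)
    dist_nonneg dist_nonneg (by linarith [dist_triangle_right (y i) q m])
    (by linarith [dist_nonneg (x := q) (y := m)])
  have h2 : |dist (y i) q - dist (y i) m| ≤ dist q m := by
    rw [dist_comm (y i), dist_comm (y i)]; exact abs_dist_sub_le q m (y i)
  have h3 := hτ.dtran_add_le (dist_nonneg (x := y i) (y := m)) (dist_nonneg (x := q) (y := m))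
  have h4 := hk i (Finset.mem_univ i)
  have h5 : |dist (y i) q - dist (y i) m| * dtran τ (dist (y i) m + dist q m) ≤
      invdtran τ (12 * b) * (5 * b) :=
    mul_le_mul (h2.trans hD2) (by linarith) (hτ.dtran_nonneg _) (invdtran_nonneg _)
  have h6 : 0 ≤ b * invdtran τ (12 * b) := mul_nonneg (ha0 k) (invdtran_nonneg _)
  linarith

end LeaveOneOut

/-! ### Exchangeability: expected excess from the leave-one-out sum. -/

section Exchangeable

lemma measurePreserving_comp_perm {S : Type*} [MeasurableSpace S] (ν : Measure S)
    [IsProbabilityMeasure ν] {k : ℕ} (σ : Equiv.Perm (Fin k)) :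
    MeasurePreserving (MeasurableEquiv.arrowCongr' σ.symm (MeasurableEquiv.refl S))
      (Measure.pi fun _ => ν) (Measure.pi fun _ => ν) :=
  measurePreserving_arrowCongr' _ _ _ _ fun _ => MeasurePreserving.id ν

variable {Q : Type*} [MetricSpace Q] {τ : ℝ → ℝ} [Nonempty Q]

lemma sampleMean_congr {ι ι' : Type*} {J : Finset ι} {J' : Finset ι'} {y : ι → Q} {y' : ι' → Q}
    (h : ∀ x, sampleObj τ J y x = sampleObj τ J' y' x) : sampleMean τ J y = sampleMean τ J' y' := by
  simp only [sampleMean, h]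

lemma sampleMean_erase_perm {k : ℕ} (y : Fin k → Q) (σ : Equiv.Perm (Fin k)) (i : Fin k) :
    sampleMean τ (Finset.univ.erase i) (fun j => y (σ j)) =
      sampleMean τ (Finset.univ.erase (σ i)) y := by
  refine sampleMean_congr fun x => ?_
  exact Finset.sum_equiv σ (by simp) (fun _ _ => rfl)

lemma sampleMean_erase_last {n : ℕ} (y : Fin (n + 1) → Q) :
    sampleMean τ (Finset.univ.erase (Fin.last n)) y =
      sampleMean τ Finset.univ fun j : Fin n => y j.castSucc := by
  refine sampleMean_congr fun x => ?_
  have h := Finset.add_sum_erase Finset.univ (fun j => τ (dist (y j) x)) (Finset.mem_univ (Fin.last n))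
  rw [Fin.sum_univ_castSucc] at h
  simp only [sampleObj]
  linarith

lemma ofReal_integral_le_lintegral {α : Type*} [MeasurableSpace α] {μ : Measure α} {f : α → ℝ}
    (hf : Integrable f μ) : ENNReal.ofReal (∫ x, f x ∂μ) ≤ ∫⁻ x, ENNReal.ofReal (f x) ∂μ := by
  have h1 : ∫ x, f x ∂μ ≤ ∫ x, max (f x) 0 ∂μ :=
    integral_mono hf hf.pos_part fun x => le_max_left _ _
  refine (ENNReal.ofReal_le_ofReal h1).trans ?_
  rw [ofReal_integral_eq_lintegral_ofReal hf.pos_part (Eventually.of_forall fun x => le_max_right _ _)]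
  exact (lintegral_congr fun x => by rcases le_total (f x) 0 with h | h <;> simp [h]).le

variable {S : Type*} [MetricSpace S] [SecondCountableTopology S] [MeasurableSpace S] [BorelSpace S]

/-- By Fubini the expected excess is the expectation of the leave-one-out term of the last of n+1
points; symmetrizing it makes the sum bound applicable, and symmetrizing back leaves the square of
the last point only. The space S is second countable so that continuous functions on its powers are
measurable for the product σ-algebra. -/
lemma lintegral_excess_le (hτ : IsTransformation τ) (hQ : IsHadamardSpace Q)
    (hU : ∀ B, ∃ x, 0 < x ∧ B < dtran τ x) {e : S → Q} (he : Continuous e)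
    (ν : Measure S) [IsProbabilityMeasure ν] (m : Q)
    (hint : Integrable (fun z => dtran τ (dist (e z) m) *
      invdtran τ (12 * dtran τ (dist (e z) m))) ν)
    (hF : ∀ q, 0 ≤ ∫ z, (τ (dist (e z) q) - τ (dist (e z) m)) ∂ν) {n : ℕ} (hn : 1 ≤ n) :
    (Measurable fun v : Fin n → S => ∫ z, (τ (dist (e z)
      (sampleMean τ Finset.univ fun j => e (v j))) - τ (dist (e z) m)) ∂ν) ∧
    ∫⁻ v : Fin n → S, ENNReal.ofReal (∫ z, (τ (dist (e z)
      (sampleMean τ Finset.univ fun j => e (v j))) - τ (dist (e z) m)) ∂ν)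
        ∂(Measure.pi fun _ => ν) ≤
    30 / n * ∫⁻ x : Fin (n + 1) → S, ENNReal.ofReal (dtran τ (dist (e (x (Fin.last n))) m) ^ 2) *
      invCurv τ (1 / n * ∑ i, dtran τ (dist (e (x i)) m)) ∂(Measure.pi fun _ => ν) := by
  set a : S → ℝ := fun z => dtran τ (dist (e z) m) with ha
  have ham : Measurable a := hτ.dtran_mono.measurable.comp (he.dist continuous_const).measurable
  set G : Fin (n + 1) → (Fin (n + 1) → S) → ℝ := fun i x =>
    τ (dist (e (x i)) (sampleMean τ (Finset.univ.erase i) fun j => e (x j))) -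
      τ (dist (e (x i)) m) with hG
  have hne : ∀ i : Fin (n + 1), ((Finset.univ : Finset (Fin (n + 1))).erase i).Nonempty :=
    fun i => Finset.card_pos.1 (by simp; omega)
  have hGc : ∀ i, Continuous (G i) := fun i => by
    refine (continuous_tau_dist hτ (by fun_prop) ?_).sub
      (continuous_tau_dist hτ (by fun_prop) continuous_const)
    exact (continuous_sampleMean hτ hQ hU (hne i)).comp
      (continuous_pi fun j => he.comp (continuous_apply j))
  have hGi : ∀ i, Integrable (G i) (Measure.pi fun _ => ν) := fun i => by
    have h1 : Integrable (fun x : Fin (n + 1) → S => 9 * ∑ j, a (x j) * invdtran τ (12 * a (x j)))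
        (Measure.pi fun _ => ν) :=
      (integrable_finsetSum _ fun j _ =>
        integrable_comp_eval (μ := fun _ : Fin (n + 1) => ν) (i := j) hint).const_mul 9
    refine h1.mono' (hGc i).aestronglyMeasurable (Eventually.of_forall fun x => ?_)
    exact abs_leaveOneOut_sub_le hτ hQ hU hn (fun j => e (x j)) m i
  have hGsym : ∀ i, ∫ x, G i x ∂(Measure.pi fun _ => ν) =
      ∫ x, G (Fin.last n) x ∂(Measure.pi fun _ => ν) := fun i => by
    rw [← (measurePreserving_comp_perm ν (Equiv.swap i (Fin.last n))).integral_comp' (G (Fin.last n))]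
    refine integral_congr_ae (Eventually.of_forall fun x => ?_)
    have h1 := sampleMean_erase_perm (τ := τ) (fun j => e (x j)) (Equiv.swap i (Fin.last n))
      (Fin.last n)
    rw [Equiv.swap_apply_right] at h1
    change G i x = τ (dist (e (x (Equiv.swap i (Fin.last n) (Fin.last n))))
      (sampleMean τ (Finset.univ.erase (Fin.last n)) fun j => e (x (Equiv.swap i (Fin.last n) j))))
      - τ (dist (e (x (Equiv.swap i (Fin.last n) (Fin.last n)))) m)
    rw [h1, Equiv.swap_apply_right]
  have hmp := measurePreserving_piFinSuccAbove (fun _ : Fin (n + 1) => ν) (Fin.last n)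
  set g : (Fin n → S) × S → ℝ := fun w => τ (dist (e w.2)
      (sampleMean τ Finset.univ fun j => e (w.1 j))) - τ (dist (e w.2) m) with hg
  have hgc : Continuous g := by
    refine (continuous_tau_dist hτ (by fun_prop) ?_).sub
      (continuous_tau_dist hτ (by fun_prop) continuous_const)
    exact (continuous_sampleMean hτ hQ hU
      (Finset.card_pos.1 (by simp; omega) : (Finset.univ : Finset (Fin n)).Nonempty)).comp
      (continuous_pi fun j => he.comp ((continuous_apply j).comp continuous_fst))
  have hGg : ∀ x, G (Fin.last n) x = g.comp Prod.swap
      (MeasurableEquiv.piFinSuccAbove (fun _ => S) (Fin.last n) x) := fun x => by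
    have h1 := sampleMean_erase_last (τ := τ) (fun j => e (x j))
    simp only [hG, h1]
    change _ = τ (dist (e (x (Fin.last n))) (sampleMean τ Finset.univ fun j : Fin n =>
      e (x ((Fin.last n).succAbove j)))) - τ (dist (e (x (Fin.last n))) m)
    simp only [Fin.succAbove_last]
  have hgi' : Integrable (g ∘ Prod.swap) (ν.prod (Measure.pi fun _ : Fin n => ν)) := by
    rw [← hmp.integrable_comp_emb (MeasurableEquiv.measurableEmbedding _)]
    exact (hGi (Fin.last n)).congr (Eventually.of_forall hGg)
  have hgi : Integrable g ((Measure.pi fun _ : Fin n => ν).prod ν) := hgi'.swap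
  have hgint : ∫ v, ∫ z, g (v, z) ∂ν ∂(Measure.pi fun _ : Fin n => ν) =
      ∫ x, G (Fin.last n) x ∂(Measure.pi fun _ => ν) := by
    rw [← integral_prod _ hgi, ← integral_prod_swap,
      ← hmp.integral_comp' (fun w => g w.swap)]
    exact integral_congr_ae (Eventually.of_forall fun x => (hGg x).symm)
  refine ⟨(hgc.measurable.stronglyMeasurable.integral_prod_right').measurable, ?_⟩
  change ∫⁻ v, ENNReal.ofReal (∫ z, g (v, z) ∂ν) ∂_ ≤ _
  rw [← ofReal_integral_eq_lintegral_ofReal hgi.integral_prod_left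
    (Eventually.of_forall fun v => hF (sampleMean τ Finset.univ fun j => e (v j))), hgint]
  set W : Fin (n + 1) → (Fin (n + 1) → S) → ℝ≥0∞ := fun i x =>
    ENNReal.ofReal (a (x i) ^ 2) * invCurv τ (1 / n * ∑ j, a (x j)) with hW
  have hWm : ∀ i, Measurable (W i) := fun i =>
    (((ham.comp (measurable_pi_apply i)).pow_const 2).ennreal_ofReal).mul
      ((hτ.invCurv_mono hU).measurable.comp
        ((Finset.measurable_sum _ fun j _ => ham.comp (measurable_pi_apply j)).const_mul _))
  have hWsym : ∀ i, ∫⁻ x, W i x ∂(Measure.pi fun _ => ν) =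
      ∫⁻ x, W (Fin.last n) x ∂(Measure.pi fun _ => ν) := fun i => by
    rw [← (measurePreserving_comp_perm ν (Equiv.swap i (Fin.last n))).lintegral_comp
      (hWm (Fin.last n))]
    refine lintegral_congr fun x => ?_
    change _ = ENNReal.ofReal (a (x (Equiv.swap i (Fin.last n) (Fin.last n))) ^ 2) *
      invCurv τ (1 / n * ∑ j, a (x (Equiv.swap i (Fin.last n) j)))
    rw [Equiv.sum_comp (Equiv.swap i (Fin.last n)) fun j => a (x j), Equiv.swap_apply_right]
  have hn1 : (0 : ℝ) < n + 1 := by positivity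
  have havg : ∫ x, G (Fin.last n) x ∂(Measure.pi fun _ => ν) =
      1 / (n + 1) * ∫ x, ∑ i, G i x ∂(Measure.pi fun _ => ν) := by
    rw [integral_finsetSum _ fun i _ => hGi i, Finset.sum_congr rfl fun i _ => hGsym i]
    rw [Finset.sum_const, Finset.card_fin, nsmul_eq_mul]
    push_cast
    field_simp
  rw [havg, ENNReal.ofReal_mul (by positivity)]
  have hsum : ENNReal.ofReal (∫ x, ∑ i, G i x ∂(Measure.pi fun _ => ν)) ≤
      30 / n * ((n + 1) * ∫⁻ x, W (Fin.last n) x ∂(Measure.pi fun _ => ν)) := by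
    refine (ofReal_integral_le_lintegral (integrable_finsetSum _ fun i _ => hGi i)).trans ?_
    calc ∫⁻ x, ENNReal.ofReal (∑ i, G i x) ∂(Measure.pi fun _ => ν)
        ≤ ∫⁻ x, 30 / n * ∑ i, W i x ∂(Measure.pi fun _ => ν) := by
          refine lintegral_mono fun x => ?_
          refine (leaveOneOut_sum_le hτ hQ hU hn (fun j => e (x j)) m).trans (le_of_eq ?_)
          rw [mul_assoc, Finset.sum_mul]
      _ = _ := by
          rw [lintegral_const_mul _ (Finset.measurable_sum _ fun i _ => hWm i),
            lintegral_finsetSum _ fun i _ => hWm i, Finset.sum_congr rfl fun i _ => hWsym i]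
          rw [Finset.sum_const, Finset.card_fin, nsmul_eq_mul]
          push_cast
          rfl
  refine (mul_le_mul_right hsum _).trans (le_of_eq ?_)
  have e1 : ENNReal.ofReal (1 / (n + 1)) * (n + 1 : ℝ≥0∞) = 1 := by
    rw [show (n + 1 : ℝ≥0∞) = ENNReal.ofReal (n + 1) by
      rw [ENNReal.ofReal_add (by positivity) zero_le_one]; simp, ← ENNReal.ofReal_mul (by positivity)]
    rw [one_div_mul_cancel hn1.ne', ENNReal.ofReal_one]
  rw [mul_left_comm, ← mul_assoc (ENNReal.ofReal _), e1, one_mul]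

end Exchangeable

/-! ### The population objective and the variance inequality. -/

section Population

variable {Ω Q : Type*} [MeasurableSpace Ω] [MetricSpace Q] [MeasurableSpace Q] [BorelSpace Q]
  {τ : ℝ → ℝ} {P : Measure Ω} [IsProbabilityMeasure P] {Y : Ω → Q} {o m : Q}

/-- Differences of τ need only the first moment of τ': they are at most d(q,q') times τ' at a
distance comparable to d(Y,o), and τ' is subadditive. -/
lemma integrable_tau_sub (hτ : IsTransformation τ) (hY : Measurable Y)
    (ho : Integrable (fun ω => dtran τ (dist (Y ω) o)) P) (q q' : Q) :
    Integrable (fun ω => τ (dist (Y ω) q) - τ (dist (Y ω) q')) P := by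
  have h1 : Integrable (fun ω => dist q q' * (dtran τ (dist (Y ω) o) +
      dtran τ (dist o q + dist o q'))) P :=
    (ho.add (integrable_const _)).const_mul _
  have hm : ∀ q : Q, Measurable fun ω => τ (dist (Y ω) q) := fun q =>
    (continuous_tau_dist hτ continuous_id continuous_const).measurable.comp hY
  refine h1.mono' ((hm q).sub (hm q')).aestronglyMeasurable (Eventually.of_forall fun ω => ?_)
  rw [Real.norm_eq_abs]
  refine (hτ.abs_sub_le (R := dist (Y ω) o + (dist o q + dist o q')) dist_nonneg dist_nonneg
    ?_ ?_).trans (mul_le_mul ?_ ?_ (hτ.dtran_nonneg _) dist_nonneg)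
  · linarith [dist_triangle (Y ω) o q, dist_nonneg (x := o) (y := q')]
  · linarith [dist_triangle (Y ω) o q', dist_nonneg (x := o) (y := q)]
  · rw [dist_comm (Y ω) q, dist_comm (Y ω) q']; exact abs_dist_sub_le q q' (Y ω)
  · exact hτ.dtran_add_le dist_nonneg (add_nonneg dist_nonneg dist_nonneg)

lemma integrable_dtran_dist (hτ : IsTransformation τ) (hY : Measurable Y)
    (ho : Integrable (fun ω => dtran τ (dist (Y ω) o)) P) (m : Q) :
    Integrable (fun ω => dtran τ (dist (Y ω) m)) P := by
  refine (ho.add (integrable_const (dtran τ (dist o m)))).mono'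
    (hτ.dtran_mono.measurable.comp ((continuous_id.dist continuous_const).measurable.comp hY)).aestronglyMeasurable
    (Eventually.of_forall fun ω => ?_)
  rw [Real.norm_eq_abs, abs_of_nonneg (hτ.dtran_nonneg _)]
  exact (hτ.dtran_mono (dist_triangle (Y ω) o m)).trans
    (hτ.dtran_add_le dist_nonneg dist_nonneg)

lemma excess_nonneg (hτ : IsTransformation τ) (hY : Measurable Y)
    (ho : Integrable (fun ω => dtran τ (dist (Y ω) o)) P) (hm : IsFrechetMean τ P Y o m) (q : Q) :
    0 ≤ ∫ ω, (τ (dist (Y ω) q) - τ (dist (Y ω) m)) ∂P := by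
  have h := hm q
  have e : ∫ ω, (τ (dist (Y ω) q) - τ (dist (Y ω) m)) ∂P =
      ∫ ω, (τ (dist (Y ω) q) - τ (dist (Y ω) o)) ∂P -
      ∫ ω, (τ (dist (Y ω) m) - τ (dist (Y ω) o)) ∂P := by
    rw [← integral_sub (integrable_tau_sub hτ hY ho q o) (integrable_tau_sub hτ hY ho m o)]
    exact integral_congr_ae (Eventually.of_forall fun ω => by ring)
  linarith

omit [MeasurableSpace Q] [BorelSpace Q] [IsProbabilityMeasure P] in
lemma IsMedian.nonneg {χ : ℝ} (hχ : IsMedian P (fun ω => dist (Y ω) m) χ) : 0 ≤ χ := by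
  have h : P {ω | dist (Y ω) m ≤ χ} ≠ 0 := fun h => by
    have := hχ.1
    rw [h] at this
    simp at this
  obtain ⟨ω, hω⟩ := nonempty_of_measure_ne_zero h
  exact dist_nonneg.trans hω

/-- On the event d(Y,m) ≤ χ, both m and q are within χ + d(m,q) of Y, so the integrand is strongly
convex along the geodesic; elsewhere it is convex. The event has probability at least 1/2, which
halves the modulus τ''/2. -/
lemma variance_inequality (hτ : IsTransformation τ) (hQ : IsHadamardSpace Q) (hY : Measurable Y)
    (ho : Integrable (fun ω => dtran τ (dist (Y ω) o)) P) (hm : IsFrechetMean τ P Y o m)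
    {χ : ℝ} (hχ : IsMedian P (fun ω => dist (Y ω) m) χ) (q : Q) :
    rderiv τ (χ + dist m q) / 4 * dist m q ^ 2 ≤
      ∫ ω, (τ (dist (Y ω) q) - τ (dist (Y ω) m)) ∂P := by
  have hi : ∀ x, Integrable (fun ω => τ (dist (Y ω) x) - τ (dist (Y ω) m)) P := fun x =>
    integrable_tau_sub hτ hY ho x m
  have hself : ∫ ω, (τ (dist (Y ω) m) - τ (dist (Y ω) m)) ∂P = 0 := by simp
  set R := χ + dist m q with hR
  have key := mul_sq_le_of_isMin hQ (F := fun x => ∫ ω, (τ (dist (Y ω) x) - τ (dist (Y ω) m)) ∂P)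
    (q := m) (p := q) (κ := rderiv τ R / 4) ?_ ?_
  · simpa using key
  · intro γ hγ t ht
    set c := rderiv τ R / 2 * (t * (1 - t) * dist m q ^ 2) with hc
    have hc0 : 0 ≤ c := mul_nonneg (by linarith [hτ.rderiv_nonneg R])
      (mul_nonneg (mul_nonneg ht.1 (sub_nonneg.2 ht.2)) (sq_nonneg _))
    set E := {ω | dist (Y ω) m ≤ χ} with hE
    have hEm : MeasurableSet E := measurableSet_le
      ((continuous_id.dist continuous_const).measurable.comp hY) measurable_const
    have hEP : 1 / 2 ≤ P.real E := by
      have := ENNReal.toReal_mono (measure_ne_top P E) hχ.1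
      simpa [Measure.real] using this
    have hind : Integrable (E.indicator fun _ => c) P :=
      (integrable_const c).indicator hEm
    have h1 : ∫ ω, (τ (dist (Y ω) (γ t)) - τ (dist (Y ω) m)) ∂P ≤
        ∫ ω, (t * (τ (dist (Y ω) q) - τ (dist (Y ω) m)) - E.indicator (fun _ => c) ω) ∂P := by
      refine integral_mono (hi _) (((hi q).const_mul t).sub hind) fun ω => ?_
      by_cases hω : ω ∈ E
      · have h2 := hτ.strongly_convex hQ hγ (z := Y ω) (R := R)
          (by linarith [show dist (Y ω) m ≤ χ from hω, dist_nonneg (x := m) (y := q)])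
          (by linarith [show dist (Y ω) m ≤ χ from hω, dist_triangle (Y ω) m q]) ht
        simp only [indicator_of_mem hω]
        linarith
      · have h2 := hτ.convex_geodesic hQ hγ (Y ω) ht
        simp only [indicator_of_notMem hω]
        linarith
    rw [integral_sub ((hi q).const_mul t) hind, integral_const_mul, integral_indicator_const _ hEm,
      smul_eq_mul] at h1
    have h3 := mul_le_mul_of_nonneg_right hEP hc0
    have h4 : rderiv τ R / 4 * (t * (1 - t) * dist m q ^ 2) = 1 / 2 * c := by rw [hc]; ring
    rw [hself, h4]
    linarith
  · intro x
    rw [hself]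
    exact excess_nonneg hτ hY ho hm x

lemma risk_integrand_le (hτ : IsTransformation τ) (hQ : IsHadamardSpace Q) (hY : Measurable Y)
    (ho : Integrable (fun ω => dtran τ (dist (Y ω) o)) P) (hm : IsFrechetMean τ P Y o m)
    {χ : ℝ} (hχ : IsMedian P (fun ω => dist (Y ω) m) χ) (q : Q) :
    ENNReal.ofReal (dist m q ^ 2) * min (ddtran τ (2 * χ)) (ddtran τ (2 * dist m q)) ≤
      4 * ENNReal.ofReal (∫ ω, (τ (dist (Y ω) q) - τ (dist (Y ω) m)) ∂P) := by
  rcases eq_or_lt_of_le (dist_nonneg (x := m) (y := q)) with h | h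
  · rw [← h]; simp
  have hR : 0 < χ + dist m q := by linarith [hχ.nonneg]
  have h1 : min (ddtran τ (2 * χ)) (ddtran τ (2 * dist m q)) ≤ ddtran τ (χ + dist m q) := by
    rcases le_total χ (dist m q) with h | h
    · exact (min_le_right _ _).trans (hτ.ddtran_antitone (by linarith))
    · exact (min_le_left _ _).trans (hτ.ddtran_antitone (by linarith))
  refine (mul_le_mul_right h1 _).trans ?_
  rw [ddtran_of_pos τ hR, ← ENNReal.ofReal_mul (sq_nonneg _),
    show (4 : ℝ≥0∞) = ENNReal.ofReal 4 by simp, ← ENNReal.ofReal_mul (by norm_num)]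
  apply ENNReal.ofReal_le_ofReal
  linarith [variance_inequality hτ hQ hY ho hm hχ q]

end Population

/-! ### Risk bound in terms of independent copies of Y. -/

section Risk

variable {Ω Q : Type*} [MeasurableSpace Ω] [MetricSpace Q] [MeasurableSpace Q] [BorelSpace Q]

/-- A separable set of full measure carries a retraction from the whole space onto a second
countable subspace that almost surely does not move the points. -/
lemma exists_secondCountable_retraction {P : Measure Ω} [IsProbabilityMeasure P] {Y : Ω → Q}
    (hYsep : ∃ A : Set Q, TopologicalSpace.IsSeparable A ∧ ∀ᵐ ω ∂P, Y ω ∈ A) :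
    ∃ S : Set Q, MeasurableSet S ∧ SecondCountableTopology S ∧ ∃ φ : Q → S, Measurable φ ∧
      ∀ᵐ ω ∂P, Y ω ∈ S ∧ ∀ z ∈ S, (φ z : Q) = z := by
  obtain ⟨A, hA, hYA⟩ := hYsep
  have hmem : ∀ᵐ ω ∂P, Y ω ∈ closure A := hYA.mono fun ω h => subset_closure h
  obtain ⟨ω₀, h₀⟩ := hmem.exists
  have hSm : MeasurableSet (closure A) := isClosed_closure.measurableSet
  have := hA.closure.separableSpace
  classical
  -- The closure is taken because A itself may fail to be Borel.
  refine ⟨closure A, hSm, UniformSpace.secondCountable_of_separable _,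
    fun z => if h : z ∈ closure A then ⟨z, h⟩ else ⟨Y ω₀, h₀⟩, ?_, ?_⟩
  · exact Measurable.dite (f := id) (g := fun _ => ⟨Y ω₀, h₀⟩) measurable_id measurable_const hSm
  · filter_upwards [hmem] with ω hω
    exact ⟨hω, fun z hz => by simp [hz]⟩

/-- The problem is moved to product measures on a second countable subspace carrying the law of Y.
Uniqueness identifies m_n almost surely with the continuous `sampleMean`, so no measurability of m_n
is required. The observation `Ys n`, outside the sample, plays the additional point; 120 = 4 · 30.
-/
lemma risk_le {P : Measure Ω} [IsProbabilityMeasure P] {τ : ℝ → ℝ} {Y : Ω → Q} {o m : Q}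
    (hτ : IsTransformation τ) (hQ : IsHadamardSpace Q)
    (hU : ∀ B, ∃ x, 0 < x ∧ B < dtran τ x) (hY : Measurable Y)
    (hYsep : ∃ A : Set Q, TopologicalSpace.IsSeparable A ∧ ∀ᵐ ω ∂P, Y ω ∈ A)
    {Ys : ℕ → Ω → Q} (hindep : iIndepFun Ys P) (hident : ∀ i, IdentDistrib (Ys i) Y P P)
    (ho : Integrable (fun ω => dtran τ (dist (Y ω) o)) P) (hm : IsFrechetMean τ P Y o m)
    (hint : Integrable (fun ω => dtran τ (dist (Y ω) m) *
      invdtran τ (12 * dtran τ (dist (Y ω) m))) P)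
    {n : ℕ} (hn : 1 ≤ n) {mn : Ω → Q}
    (hmn : ∀ᵐ ω ∂P, IsSampleFrechetMean τ n (fun j => Ys j ω) (mn ω))
    {χ : ℝ} (hχ : IsMedian P (fun ω => dist (Y ω) m) χ) :
    risk τ P m χ mn ≤ 120 / n * ∫⁻ ω, ENNReal.ofReal (dtran τ (dist (Ys n ω) m) ^ 2) *
      invCurv τ (sigmaHat τ n (fun j => Ys j ω) m + 1 / n * dtran τ (dist (Ys n ω) m)) ∂P := by
  have := hQ.nonempty
  obtain ⟨S, hSm, hSc, φ, hφ, hYS⟩ := exists_secondCountable_retraction hYsep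
  have hφS : ∀ z ∈ S, (φ z : Q) = z := hYS.exists.choose_spec.2
  have hYS' : ∀ᵐ ω ∂P, (φ (Y ω) : Q) = Y ω := hYS.mono fun ω h => h.2 _ h.1
  have hYsm : ∀ i, AEMeasurable (Ys i) P := fun i => (hident i).aemeasurable_fst
  have hYsS : ∀ᵐ ω ∂P, ∀ i, (φ (Ys i ω) : Q) = Ys i ω := by
    rw [ae_all_iff]
    intro i
    have h1 : ∀ᵐ ω ∂P, Ys i ω ∈ S :=
      (hident i).symm.ae_mem_snd hSm (hYS.mono fun ω h => h.1)
    exact h1.mono fun ω h => hφS _ h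
  set ν := P.map fun ω => φ (Y ω) with hν
  have hφY : Measurable fun ω => φ (Y ω) := hφ.comp hY
  have : IsProbabilityMeasure ν := Measure.isProbabilityMeasure_map hφY.aemeasurable
  have hmapi : ∀ i, P.map (fun ω => φ (Ys i ω)) = ν := fun i => ((hident i).comp hφ).map_eq
  have hφYs : ∀ i, AEMeasurable (fun ω => φ (Ys i ω)) P := fun i => hφ.comp_aemeasurable (hYsm i)
  have hind : iIndepFun (fun i ω => φ (Ys i ω)) P := hindep.comp (fun _ => φ) fun _ => hφ
  have hlaw : ∀ k : ℕ, P.map (fun ω (i : Fin k) => φ (Ys i ω)) = Measure.pi fun _ => ν := fun k => by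
    have h1 := hind.precomp (g := fun i : Fin k => (i : ℕ)) Fin.val_injective
    have h2 := (iIndepFun_iff_map_fun_eq_pi_map (f := fun (i : Fin k) ω => φ (Ys i ω))
      fun i => hφYs i).1 h1
    rw [h2]
    simp only [hmapi]
  have hvec : ∀ k : ℕ, AEMeasurable (fun ω (i : Fin k) => φ (Ys i ω)) P := fun k =>
    aemeasurable_pi_lambda _ fun i => hφYs i
  have hav : Measurable fun z : S => dtran τ (dist (z : Q) m) :=
    hτ.dtran_mono.measurable.comp (continuous_subtype_val.dist continuous_const).measurable
  have hintν : Integrable (fun z : S => dtran τ (dist (z : Q) m) *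
      invdtran τ (12 * dtran τ (dist (z : Q) m))) ν := by
    rw [hν, integrable_map_measure ?_ hφY.aemeasurable]
    · refine hint.congr (hYS'.mono fun ω h => ?_)
      simp only [Function.comp, h]
    · exact (hav.mul ((hτ.invdtran_mono hU).measurable.comp
        (hav.const_mul 12))).aestronglyMeasurable
  have hexc : ∀ q, ∫ z : S, (τ (dist (z : Q) q) - τ (dist (z : Q) m)) ∂ν =
      ∫ ω, (τ (dist (Y ω) q) - τ (dist (Y ω) m)) ∂P := fun q => by
    rw [hν, integral_map hφY.aemeasurable]
    · refine integral_congr_ae (hYS'.mono fun ω h => ?_)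
      simp only [h]
    · exact ((continuous_tau_dist hτ continuous_subtype_val continuous_const).sub
        (continuous_tau_dist hτ continuous_subtype_val continuous_const)).aestronglyMeasurable
  obtain ⟨hmeas, hle⟩ := lintegral_excess_le hτ hQ hU (continuous_subtype_val (p := (· ∈ S))) ν m
    hintν (fun q => by rw [hexc]; exact excess_nonneg hτ hY ho hm q) hn
  have hstep : risk τ P m χ mn ≤ 4 * ∫⁻ v : Fin n → S, ENNReal.ofReal (∫ z : S, (τ (dist (z : Q)
      (sampleMean τ Finset.univ fun j => (v j : Q))) - τ (dist (z : Q) m)) ∂ν)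
        ∂(Measure.pi fun _ => ν) := by
    rw [← hlaw n, lintegral_map' hmeas.ennreal_ofReal.aemeasurable (hvec n),
      ← lintegral_const_mul' _ _ (by simp)]
    refine lintegral_mono_ae ?_
    filter_upwards [hmn, hYsS] with ω hω hS
    refine (risk_integrand_le hτ hQ hY ho hm hχ (mn ω)).trans (le_of_eq ?_)
    have hne : (Finset.univ : Finset (Fin n)).Nonempty := Finset.card_pos.1 (by simp; omega)
    have hobj : ∀ x, sampleObj τ Finset.univ (fun j : Fin n => Ys j ω) x =
        ∑ j ∈ Finset.range n, τ (dist (Ys j ω) x) := fun x =>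
      (Finset.sum_range fun j => τ (dist (Ys j ω) x)).symm
    have heq : mn ω = sampleMean τ Finset.univ fun j : Fin n => Ys j ω :=
      sampleObj_min_unique hτ hQ hU hne (fun x => by rw [hobj, hobj]; exact hω x)
        (sampleMean_spec hτ hQ hU hne _)
    simp only [hS, hexc, ← heq]
  have hlast : ∫⁻ x : Fin (n + 1) → S, ENNReal.ofReal (dtran τ (dist (x (Fin.last n) : Q) m) ^ 2) *
      invCurv τ (1 / n * ∑ i, dtran τ (dist (x i : Q) m)) ∂(Measure.pi fun _ => ν) =
      ∫⁻ ω, ENNReal.ofReal (dtran τ (dist (Ys n ω) m) ^ 2) *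
      invCurv τ (sigmaHat τ n (fun j => Ys j ω) m + 1 / n * dtran τ (dist (Ys n ω) m)) ∂P := by
    rw [← hlaw (n + 1), lintegral_map' _ (hvec (n + 1))]
    · refine lintegral_congr_ae (hYsS.mono fun ω h => ?_)
      simp only [h, Fin.sum_univ_castSucc, Fin.val_last, Fin.val_castSucc, sigmaHat,
        Finset.sum_range, mul_add]
    · have hj : ∀ j : Fin (n + 1), Measurable fun x : Fin (n + 1) → S =>
          dtran τ (dist (x j : Q) m) := fun j => hav.comp (measurable_pi_apply j)
      exact ((((hj _).pow_const 2).ennreal_ofReal).mul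
        ((hτ.invCurv_mono hU).measurable.comp ((Finset.measurable_sum Finset.univ fun j _ =>
          hj j).const_mul (1 / (n : ℝ))))).aemeasurable
  refine hstep.trans ((mul_le_mul_right hle _).trans (le_of_eq ?_))
  rw [hlast, ← mul_assoc]
  congr 1
  rw [← mul_div_assoc]
  norm_num

end Risk

/-! ### Upper tails of averages of independent copies. -/

section IID

variable {Ω : Type*} [MeasurableSpace Ω] {P : Measure Ω} [IsProbabilityMeasure P]
  {X : ℕ → Ω → ℝ} {Z : Ω → ℝ} {H : ℝ → ℝ≥0∞}

lemma measure_sum_ge_le (hind : iIndepFun X P) (hid : ∀ i, IdentDistrib (X i) Z P P)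
    (hZ : MemLp Z 2 P) (J : Finset ℕ) {t : ℝ} (ht : 0 < t) :
    P {ω | J.card * ∫ ω, Z ω ∂P + t ≤ ∑ j ∈ J, X j ω} ≤
      ENNReal.ofReal (J.card * Var[Z; P] / t ^ 2) := by
  have hX : ∀ i, MemLp (X i) 2 P := fun i => (hid i).memLp_iff.2 hZ
  have hS : MemLp (∑ j ∈ J, X j) 2 P := memLp_finsetSum' J fun j _ => hX j
  have h := meas_ge_le_variance_div_sq hS ht
  have hE : ∫ ω, (∑ j ∈ J, X j) ω ∂P = J.card * ∫ ω, Z ω ∂P := by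
    simp only [Finset.sum_apply]
    rw [integral_finsetSum _ fun j _ => (hX j).integrable (by norm_num)]
    rw [Finset.sum_congr rfl fun j _ => (hid j).integral_eq, Finset.sum_const, nsmul_eq_mul]
  have hV : Var[∑ j ∈ J, X j; P] = J.card * Var[Z; P] := by
    rw [IndepFun.variance_sum (fun j _ => hX j) fun i _ j _ hij => hind.indepFun hij]
    rw [Finset.sum_congr rfl fun j _ => (hid j).variance_eq, Finset.sum_const, nsmul_eq_mul]
  rw [hE, hV] at h
  refine (measure_mono fun ω hω => ?_).trans h
  have hω' : J.card * ∫ ω, Z ω ∂P + t ≤ ∑ j ∈ J, X j ω := hω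
  have h2 := le_abs_self ((∑ j ∈ J, X j) ω - J.card * ∫ ω, Z ω ∂P)
  rw [mem_ofPred_eq]
  rw [Finset.sum_apply] at h2 ⊢
  linarith

omit [IsProbabilityMeasure P] in
lemma lintegral_indicator_tail_le {t : ℝ} (ht : 0 < t) :
    ∫⁻ ω, {ω | t < Z ω}.indicator (fun ω => H (Z ω)) ω ∂P ≤
      ENNReal.ofReal (1 / t ^ 2) * ∫⁻ ω, ENNReal.ofReal (Z ω ^ 2) * H (Z ω) ∂P := by
  rw [← lintegral_const_mul' _ _ ENNReal.ofReal_ne_top]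
  refine lintegral_mono fun ω => ?_
  by_cases h : t < Z ω
  · rw [indicator_of_mem (by exact h), ← mul_assoc, ← ENNReal.ofReal_mul (by positivity)]
    have h1 : 1 ≤ 1 / t ^ 2 * Z ω ^ 2 := by
      rw [one_div_mul_eq_div, le_div_iff₀ (by positivity), one_mul]
      exact pow_le_pow_left₀ ht.le h.le 2
    calc H (Z ω) = 1 * H (Z ω) := (one_mul _).symm
      _ ≤ _ := mul_le_mul_left (by simpa using ENNReal.ofReal_le_ofReal h1) _
  · rw [indicator_of_notMem (by exact h)]; exact zero_le

/-- If the average s is at most M, bound H(s) by H(M) and use Chebyshev. If s > M, some summand X_j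
is at least s, so H(s) ≤ H(X_j), and either X_j or the independent sum of the others exceeds nM/2.
Second moments make both alternatives summable over the n indices. -/
lemma lintegral_mean_tail_le (hind : iIndepFun X P) (hid : ∀ i, IdentDistrib (X i) Z P P)
    (hZ : MemLp Z 2 P) (hH : Monotone H) (hσ : 0 < ∫ ω, Z ω ∂P)
    {M : ℝ} (hM : 4 * ∫ ω, Z ω ∂P ≤ M) {n : ℕ} (hn : 1 ≤ n) :
    ∫⁻ ω, {ω | 3 / 2 * ∫ ω, Z ω ∂P < 1 / (n : ℝ) * ∑ j ∈ Finset.range n, X j ω}.indicator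
      (fun ω => H (1 / (n : ℝ) * ∑ j ∈ Finset.range n, X j ω)) ω ∂P ≤
    H M * ENNReal.ofReal (4 * Var[Z; P] / (∫ ω, Z ω ∂P) ^ 2 * (n : ℝ)⁻¹) +
      (ENNReal.ofReal (4 / M ^ 2 * (n : ℝ)⁻¹) + ENNReal.ofReal (16 * Var[Z; P] / M ^ 4)) *
        ∫⁻ ω, ENNReal.ofReal (Z ω ^ 2) * H (Z ω) ∂P := by
  have hn0 : (0 : ℝ) < n := by exact_mod_cast hn
  set σ := ∫ ω, Z ω ∂P with hσd
  set V := Var[Z; P] with hV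
  have hV0 : 0 ≤ V := variance_nonneg _ _
  have hM0 : 0 < M := by linarith
  set C := ∫⁻ ω, ENNReal.ofReal (Z ω ^ 2) * H (Z ω) ∂P with hC
  have hXm : ∀ i, AEMeasurable (X i) P := fun i => (hid i).aemeasurable_fst
  have hCj : ∀ j, ∫⁻ ω, ENNReal.ofReal (X j ω ^ 2) * H (X j ω) ∂P = C := fun j =>
    ((hid j).comp (u := fun x => ENNReal.ofReal (x ^ 2) * H x)
      ((measurable_id.pow_const 2).ennreal_ofReal.mul hH.measurable)).lintegral_eq
  set rest : ℕ → Ω → ℝ := fun j ω => ∑ k ∈ (Finset.range n).erase j, X k ω with hrest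
  have hrm : ∀ j, AEMeasurable (rest j) P := fun j =>
    Finset.aemeasurable_fun_sum _ fun k _ => hXm k
  have hmt : ∀ t : ℝ, Measurable (Set.indicator {x : ℝ | t < x} (H : ℝ → ℝ≥0∞)) := fun t =>
    hH.measurable.indicator measurableSet_Ioi
  have hmo : ∀ t : ℝ, Measurable (Set.indicator {x : ℝ | t < x} (1 : ℝ → ℝ≥0∞)) := fun t =>
    measurable_one.indicator measurableSet_Ioi
  have hpt : ∀ ω, {ω | 3 / 2 * σ < 1 / (n : ℝ) * ∑ j ∈ Finset.range n, X j ω}.indicator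
      (fun ω => H (1 / (n : ℝ) * ∑ j ∈ Finset.range n, X j ω)) ω ≤
      {ω | n * σ + n * σ / 2 ≤ ∑ j ∈ Finset.range n, X j ω}.indicator (fun _ => H M) ω +
      ∑ j ∈ Finset.range n, (Set.indicator {x : ℝ | n * M / 2 < x} H (X j ω) +
        Set.indicator {x : ℝ | M < x} H (X j ω) *
          Set.indicator {x : ℝ | n * M / 2 < x} 1 (rest j ω)) := by
    intro ω
    by_cases h : 3 / 2 * σ < 1 / (n : ℝ) * ∑ j ∈ Finset.range n, X j ω
    swap
    · rw [indicator_of_notMem (by exact h)]; exact zero_le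
    rw [indicator_of_mem (by exact h)]
    set s := 1 / (n : ℝ) * ∑ j ∈ Finset.range n, X j ω with hs
    have hns : ∑ j ∈ Finset.range n, X j ω = n * s := by rw [hs]; field_simp
    rcases le_or_gt s M with hsM | hsM
    · refine le_add_right ?_
      rw [indicator_of_mem]
      · exact hH hsM
      · rw [mem_ofPred_eq, hns]
        have := mul_lt_mul_of_pos_left h hn0
        linarith
    · refine le_add_left ?_
      obtain ⟨j, hj, hjs⟩ : ∃ j ∈ Finset.range n, s ≤ X j ω := by
        refine Finset.exists_le_of_sum_le (f := fun _ => s) (Finset.nonempty_range_iff.2 (by omega)) ?_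
        rw [Finset.sum_const, Finset.card_range, nsmul_eq_mul, hns]
      refine le_trans ?_ (Finset.single_le_sum
        (f := fun j => Set.indicator {x : ℝ | n * M / 2 < x} H (X j ω) +
        Set.indicator {x : ℝ | M < x} H (X j ω) *
          Set.indicator {x : ℝ | n * M / 2 < x} 1 (rest j ω)) (fun _ _ => zero_le) hj)
      refine (hH hjs).trans ?_
      have hsplit : X j ω + rest j ω = n * s := by
        rw [← hns]; exact Finset.add_sum_erase _ (fun k => X k ω) hj
      rcases lt_or_ge (n * M / 2) (X j ω) with h1 | h1
      · refine le_add_right ?_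
        rw [indicator_of_mem (by exact h1)]
      · refine le_add_left ?_
        have h2 : n * M / 2 < rest j ω := by
          have := mul_lt_mul_of_pos_left hsM hn0
          linarith
        rw [indicator_of_mem (show X j ω ∈ {x : ℝ | M < x} from hsM.trans_le hjs),
          indicator_of_mem (show rest j ω ∈ {x : ℝ | n * M / 2 < x} from h2), Pi.one_apply, mul_one]
  refine (lintegral_mono hpt).trans ?_
  have hAm : NullMeasurableSet {ω | n * σ + n * σ / 2 ≤ ∑ j ∈ Finset.range n, X j ω} P :=
    nullMeasurableSet_le aemeasurable_const (Finset.aemeasurable_fun_sum _ fun k _ => hXm k)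
  have hm1 : ∀ j, AEMeasurable (fun ω => Set.indicator {x : ℝ | n * M / 2 < x} H (X j ω)) P :=
    fun j => (hmt _).comp_aemeasurable (hXm j)
  have hm2 : ∀ j, AEMeasurable (fun ω => Set.indicator {x : ℝ | M < x} H (X j ω)) P :=
    fun j => (hmt _).comp_aemeasurable (hXm j)
  have hm3 : ∀ j, AEMeasurable
      (fun ω => Set.indicator {x : ℝ | n * M / 2 < x} (1 : ℝ → ℝ≥0∞) (rest j ω)) P :=
    fun j => (hmo _).comp_aemeasurable (hrm j)
  have hm4 : ∀ j, AEMeasurable (fun ω => Set.indicator {x : ℝ | n * M / 2 < x} H (X j ω) +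
      Set.indicator {x : ℝ | M < x} H (X j ω) *
        Set.indicator {x : ℝ | n * M / 2 < x} 1 (rest j ω)) P :=
    fun j => (hm1 j).add ((hm2 j).mul (hm3 j))
  rw [lintegral_add_left' (aemeasurable_const.indicator₀ hAm), lintegral_indicator_const₀ hAm,
    lintegral_finsetSum' _ fun j _ => hm4 j]
  gcongr
  · have h := measure_sum_ge_le hind hid hZ (Finset.range n) (t := n * σ / 2) (by positivity)
    rw [Finset.card_range] at h
    refine h.trans (ENNReal.ofReal_le_ofReal (le_of_eq ?_))
    rw [← hσd] at *
    field_simp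
    ring
  · have hterm : ∀ j ∈ Finset.range n,
        ∫⁻ ω, (Set.indicator {x : ℝ | n * M / 2 < x} H (X j ω) +
          Set.indicator {x : ℝ | M < x} H (X j ω) *
            Set.indicator {x : ℝ | n * M / 2 < x} 1 (rest j ω)) ∂P ≤
        (ENNReal.ofReal (1 / (n * M / 2) ^ 2) +
          ENNReal.ofReal (1 / M ^ 2) * ENNReal.ofReal (16 * V / (n * M ^ 2))) * C := by
      intro j hj
      rw [lintegral_add_left' (hm1 j), add_mul]
      have t1 := lintegral_indicator_tail_le (P := P) (Z := X j) (H := H) (t := n * M / 2)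
        (by positivity)
      have t2 := lintegral_indicator_tail_le (P := P) (Z := X j) (H := H) (t := M) hM0
      rw [hCj] at t1 t2
      have hindj : IndepFun (X j) (rest j) P := by
        have := (hind.indepFun_finsetSum_of_notMem₀ hXm
          (Finset.notMem_erase j (Finset.range n))).symm
        convert this using 1
        ext ω
        simp [hrest]
      have t3 : ∫⁻ ω, Set.indicator {x : ℝ | n * M / 2 < x} (1 : ℝ → ℝ≥0∞) (rest j ω) ∂P ≤
          ENNReal.ofReal (16 * V / (n * M ^ 2)) := by
        have hcard : (((Finset.range n).erase j).card : ℝ) ≤ n := by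
          exact_mod_cast (Finset.card_erase_le).trans (Finset.card_range n).le
        have hset : MeasurableSet {x : ℝ | n * M / 2 < x} := measurableSet_Ioi
        have e : ∀ ω, Set.indicator {x : ℝ | n * M / 2 < x} (1 : ℝ → ℝ≥0∞) (rest j ω) =
            Set.indicator (rest j ⁻¹' {x : ℝ | n * M / 2 < x}) 1 ω := fun ω => rfl
        simp only [e]
        rw [lintegral_indicator_one₀ ((hrm j).nullMeasurable hset)]
        -- M ≥ 4σ makes the mean of the remaining sum at most nM/4, half of the threshold.
        have h := measure_sum_ge_le hind hid hZ ((Finset.range n).erase j) (t := n * M / 4)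
          (by positivity)
        refine (measure_mono fun ω hω => ?_).trans (h.trans (ENNReal.ofReal_le_ofReal ?_))
        · have hω' : n * M / 2 < rest j ω := hω
          rw [mem_ofPred_eq]
          have h2 := mul_le_mul_of_nonneg_right hcard hσ.le
          have h3 := mul_le_mul_of_nonneg_left hM hn0.le
          change _ ≤ rest j ω
          rw [← hσd]
          linarith
        · have e : 16 * V / (n * M ^ 2) = n * V / (n * M / 4) ^ 2 := by field_simp; ring
          rw [e]
          gcongr
      refine add_le_add t1 ?_
      rw [lintegral_mul_eq_lintegral_mul_lintegral_of_indepFun'' (hm2 j) (hm3 j)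
        (hindj.comp (hmt M) (hmo _))]
      calc _ ≤ (ENNReal.ofReal (1 / M ^ 2) * C) * ENNReal.ofReal (16 * V / (n * M ^ 2)) :=
            mul_le_mul' t2 t3
        _ = _ := by ring
    refine (Finset.sum_le_sum hterm).trans (le_of_eq ?_)
    rw [Finset.sum_const, Finset.card_range, nsmul_eq_mul, ← mul_assoc, mul_add]
    congr 2
    · rw [show (n : ℝ≥0∞) = ENNReal.ofReal n by simp, ← ENNReal.ofReal_mul hn0.le]
      congr 1
      field_simp
      norm_num
    · rw [← ENNReal.ofReal_mul (by positivity), show (n : ℝ≥0∞) = ENNReal.ofReal n by simp,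
        ← ENNReal.ofReal_mul hn0.le]
      congr 1
      field_simp

lemma tendsto_lintegral_mean_tail (hind : iIndepFun X P) (hid : ∀ i, IdentDistrib (X i) Z P P)
    (hZ : MemLp Z 2 P) (hH : Monotone H) (hHtop : ∀ x, H x < ∞)
    (hσ : 0 < ∫ ω, Z ω ∂P) (hC : ∫⁻ ω, ENNReal.ofReal (Z ω ^ 2) * H (Z ω) ∂P < ∞) :
    Tendsto (fun n : ℕ => ∫⁻ ω, {ω | 3 / 2 * ∫ ω, Z ω ∂P <
      1 / (n : ℝ) * ∑ j ∈ Finset.range n, X j ω}.indicator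
        (fun ω => H (1 / (n : ℝ) * ∑ j ∈ Finset.range n, X j ω)) ω ∂P) atTop (𝓝 0) := by
  set σ := ∫ ω, Z ω ∂P with hσd
  set V := Var[Z; P] with hV
  set C := ∫⁻ ω, ENNReal.ofReal (Z ω ^ 2) * H (Z ω) ∂P with hCd
  have hlimM : Tendsto (fun M : ℝ => ENNReal.ofReal (16 * V / M ^ 4) * C) atTop (𝓝 0) := by
    have h1 : Tendsto (fun M : ℝ => 16 * V / M ^ 4) atTop (𝓝 0) :=
      tendsto_const_nhds.div_atTop (tendsto_pow_atTop (by norm_num))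
    have h2 := ENNReal.Tendsto.mul_const (b := C) (ENNReal.tendsto_ofReal h1) (Or.inr hC.ne)
    simpa using h2
  rw [ENNReal.tendsto_nhds_zero]
  intro ε hε
  -- First M is chosen to make the term without decay in n small, then n grows.
  obtain ⟨M, hMε, hM⟩ := ((hlimM.eventually (gt_mem_nhds hε)).and
    (eventually_ge_atTop (4 * σ))).exists
  have hinv : Tendsto (fun n : ℕ => (n : ℝ)⁻¹) atTop (𝓝 0) := tendsto_inv_atTop_nhds_zero_nat
  have hl : Tendsto (fun n : ℕ => H M * ENNReal.ofReal (4 * V / σ ^ 2 * (n : ℝ)⁻¹) +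
      (ENNReal.ofReal (4 / M ^ 2 * (n : ℝ)⁻¹) + ENNReal.ofReal (16 * V / M ^ 4)) * C) atTop
      (𝓝 (H M * ENNReal.ofReal (4 * V / σ ^ 2 * 0) +
        (ENNReal.ofReal (4 / M ^ 2 * 0) + ENNReal.ofReal (16 * V / M ^ 4)) * C)) :=
    (ENNReal.Tendsto.const_mul (ENNReal.tendsto_ofReal (hinv.const_mul _))
      (Or.inr (hHtop M).ne)).add (ENNReal.Tendsto.mul_const
        ((ENNReal.tendsto_ofReal (hinv.const_mul _)).add tendsto_const_nhds) (Or.inr hC.ne))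
  simp only [mul_zero, ENNReal.ofReal_zero, zero_add] at hl
  filter_upwards [hl.eventually (gt_mem_nhds hMε), eventually_ge_atTop 1] with n hn hn1
  exact (lintegral_mean_tail_le hind hid hZ hH hσ hM hn1).trans hn.le

end IID

/-! ### Decoupling the new observation from the sample average. -/

section Asymptotics

variable {Ω : Type*} [MeasurableSpace Ω] {P : Measure Ω} [IsProbabilityMeasure P]
  {X : ℕ → Ω → ℝ} {Z : Ω → ℝ} {τ : ℝ → ℝ}

lemma memLp_two_of_lintegral_hFun (hτ : IsTransformation τ)
    (hU : ∀ B, ∃ x, 0 < x ∧ B < dtran τ x) (hZm : AEMeasurable Z P) (hZ0 : ∀ ω, 0 ≤ Z ω)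
    (hC : ∫⁻ ω, ENNReal.ofReal (Z ω ^ 2) * hFun τ (Z ω) ∂P < ∞) : MemLp Z 2 P := by
  rw [memLp_two_iff_integrable_sq hZm.aestronglyMeasurable,
    ← lintegral_ofReal_ne_top_iff_integrable (hZm.pow_const 2).aestronglyMeasurable
      (Eventually.of_forall fun ω => sq_nonneg _)]
  -- Exceeding τ'(0) makes (τ')⁻¹(12K) positive, hence h(K) > 0; at 0 the value 1/τ''(0) could
  -- vanish.
  set K := dtran τ 0 + 1 with hK
  have hK0 := hτ.dtran_zero_nonneg
  have hpos : hFun τ K ≠ 0 := by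
    have h7 : 0 < 7 * invdtran τ (12 * K) := by
      have := hτ.invdtran_pos hU (z := 12 * K) (by linarith)
      linarith
    rw [hFun, gFun, ddtran_of_pos τ h7]
    exact ENNReal.inv_ne_zero.2 ENNReal.ofReal_ne_top
  have hle : ∫⁻ ω, ENNReal.ofReal (Z ω ^ 2) ∂P ≤ ∫⁻ ω, (ENNReal.ofReal (K ^ 2) +
      (hFun τ K)⁻¹ * (ENNReal.ofReal (Z ω ^ 2) * hFun τ (Z ω))) ∂P := by
    refine lintegral_mono fun ω => ?_
    rcases le_total (Z ω) K with h | h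
    · exact le_add_right (ENNReal.ofReal_le_ofReal (pow_le_pow_left₀ (hZ0 ω) h 2))
    · refine le_add_left ?_
      rw [mul_left_comm]
      refine le_mul_of_one_le_right' ?_
      rw [← ENNReal.inv_mul_cancel hpos (hτ.hFun_lt_top hU K).ne]
      exact mul_le_mul_right (hτ.hFun_mono hU h) _
  refine (hle.trans_lt ?_).ne
  rw [lintegral_add_left measurable_const, lintegral_const, measure_univ, mul_one,
    lintegral_const_mul' _ _ (ENNReal.inv_ne_top.2 hpos)]
  exact ENNReal.add_lt_top.2 ⟨ENNReal.ofReal_lt_top,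
    ENNReal.mul_lt_top (ENNReal.inv_lt_top.2 (pos_iff_ne_zero.2 hpos)) hC⟩

omit [IsProbabilityMeasure P] in
lemma integrable_mul_invdtran (hτ : IsTransformation τ)
    (hU : ∀ B, ∃ x, 0 < x ∧ B < dtran τ x) (hZm : AEMeasurable Z P) (hZ0 : ∀ ω, 0 ≤ Z ω)
    (hC : ∫⁻ ω, ENNReal.ofReal (Z ω ^ 2) * hFun τ (Z ω) ∂P < ∞) :
    Integrable (fun ω => Z ω * invdtran τ (12 * Z ω)) P := by
  have hm : AEMeasurable (fun ω => Z ω * invdtran τ (12 * Z ω)) P :=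
    hZm.mul ((hτ.invdtran_mono hU).measurable.comp_aemeasurable (hZm.const_mul 12))
  rw [← lintegral_ofReal_ne_top_iff_integrable hm.aestronglyMeasurable
    (Eventually.of_forall fun ω => mul_nonneg (hZ0 ω) (invdtran_nonneg _))]
  refine (lt_of_le_of_lt (lintegral_mono (g := fun ω =>
    12 * (ENNReal.ofReal (Z ω ^ 2) * hFun τ (Z ω))) fun ω => ?_) ?_).ne
  · have h := hτ.invdtran_le_mul_hFun hU (hZ0 ω)
    dsimp only
    rw [ENNReal.ofReal_mul (hZ0 ω), ENNReal.ofReal_pow (hZ0 ω)]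
    refine (mul_le_mul_right h _).trans (le_of_eq ?_)
    ring
  · rw [lintegral_const_mul' _ _ (by simp)]
    exact ENNReal.mul_lt_top (by simp) hC

omit [IsProbabilityMeasure P] in
lemma lintegral_sq_mul_sum (hind : iIndepFun X P) (hid : ∀ i, IdentDistrib (X i) Z P P) (n : ℕ)
    {w : ℝ → ℝ≥0∞} (hw : Measurable w) :
    ∫⁻ ω, ENNReal.ofReal (X n ω ^ 2) * w (∑ j ∈ Finset.range n, X j ω) ∂P =
      (∫⁻ ω, ENNReal.ofReal (Z ω ^ 2) ∂P) * ∫⁻ ω, w (∑ j ∈ Finset.range n, X j ω) ∂P := by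
  have hXm : ∀ i, AEMeasurable (X i) P := fun i => (hid i).aemeasurable_fst
  have hsq : Measurable fun x : ℝ => ENNReal.ofReal (x ^ 2) :=
    (measurable_id.pow_const 2).ennreal_ofReal
  have hSm : AEMeasurable (fun ω => ∑ j ∈ Finset.range n, X j ω) P :=
    Finset.aemeasurable_fun_sum _ fun k _ => hXm k
  have hI : IndepFun (X n) (fun ω => ∑ j ∈ Finset.range n, X j ω) P := by
    have := (hind.indepFun_finsetSum_of_notMem₀ hXm
      (Finset.notMem_range_self (n := n))).symm
    convert this using 1
    ext ω
    simp
  have h := lintegral_mul_eq_lintegral_mul_lintegral_of_indepFun''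
    (hsq.comp_aemeasurable (hXm n)) (hw.comp_aemeasurable hSm) (hI.comp hsq hw)
  have h2 : ∫⁻ ω, ENNReal.ofReal (X n ω ^ 2) ∂P = ∫⁻ ω, ENNReal.ofReal (Z ω ^ 2) ∂P :=
    ((hid n).comp hsq).lintegral_eq
  rw [← h2]
  exact h

omit [IsProbabilityMeasure P] in
lemma lintegral_sq_invCurv_le (hτ : IsTransformation τ)
    (hU : ∀ B, ∃ x, 0 < x ∧ B < dtran τ x) (hind : iIndepFun X P)
    (hid : ∀ i, IdentDistrib (X i) Z P P) (hX0 : ∀ i ω, 0 ≤ X i ω) (n : ℕ) :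
    ∫⁻ ω, ENNReal.ofReal (X n ω ^ 2) *
      invCurv τ (1 / (n : ℝ) * ∑ j ∈ Finset.range n, X j ω + 1 / n * X n ω) ∂P ≤
    (∫⁻ ω, ENNReal.ofReal (Z ω ^ 2) ∂P) *
      ∫⁻ ω, hFun τ (2 * (1 / (n : ℝ) * ∑ j ∈ Finset.range n, X j ω)) ∂P +
    ∫⁻ ω, ENNReal.ofReal (Z ω ^ 2) * hFun τ (1 / n * Z ω) ∂P := by
  have hXm : ∀ i, AEMeasurable (X i) P := fun i => (hid i).aemeasurable_fst
  have hh := (hτ.hFun_mono hU).measurable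
  have hsq : Measurable fun x : ℝ => ENNReal.ofReal (x ^ 2) :=
    (measurable_id.pow_const 2).ennreal_ofReal
  have hsum : Measurable fun x : ℝ => hFun τ (2 * (1 / (n : ℝ) * x)) :=
    hh.comp ((measurable_id.const_mul _).const_mul _)
  have hSm : AEMeasurable (fun ω => ∑ j ∈ Finset.range n, X j ω) P :=
    Finset.aemeasurable_fun_sum _ fun k _ => hXm k
  have e1 := lintegral_sq_mul_sum hind hid n hsum
  have hm : AEMeasurable (fun ω => ENNReal.ofReal (X n ω ^ 2) *
      hFun τ (2 * (1 / (n : ℝ) * ∑ j ∈ Finset.range n, X j ω))) P :=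
    (hsq.comp_aemeasurable (hXm n)).mul (hsum.comp_aemeasurable hSm)
  have e2 : ∫⁻ ω, ENNReal.ofReal (X n ω ^ 2) * hFun τ (1 / n * X n ω) ∂P =
      ∫⁻ ω, ENNReal.ofReal (Z ω ^ 2) * hFun τ (1 / n * Z ω) ∂P :=
    ((hid n).comp (u := fun x => ENNReal.ofReal (x ^ 2) * hFun τ (1 / n * x))
      (hsq.mul (hh.comp (measurable_id.const_mul _)))).lintegral_eq
  rw [← e1, ← e2, ← lintegral_add_left' hm]
  refine lintegral_mono fun ω => ?_
  refine le_trans (mul_le_mul_right ?_ _) (mul_add _ _ _).le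
  have hs0 : 0 ≤ 1 / (n : ℝ) * ∑ j ∈ Finset.range n, X j ω :=
    mul_nonneg (by positivity) (Finset.sum_nonneg fun j _ => hX0 j ω)
  -- The sum of the two terms is at most twice the larger one, which `invCurv_le_hFun` absorbs.
  rcases le_total (1 / n * X n ω) (1 / (n : ℝ) * ∑ j ∈ Finset.range n, X j ω) with h | h
  · exact le_add_right (hτ.invCurv_le_hFun hU (by linarith))
  · exact le_add_left (hτ.invCurv_le_hFun hU (by linarith))

omit [IsProbabilityMeasure P] in
lemma lintegral_sq_hFun_div_le (hτ : IsTransformation τ)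
    (hU : ∀ B, ∃ x, 0 < x ∧ B < dtran τ x) (hZ0 : ∀ ω, 0 ≤ Z ω) (n : ℕ) :
    ∫⁻ ω, ENNReal.ofReal (Z ω ^ 2) * hFun τ (1 / n * Z ω) ∂P ≤
      ∫⁻ ω, ENNReal.ofReal (Z ω ^ 2) * hFun τ (Z ω) ∂P := by
  refine lintegral_mono fun ω => mul_le_mul_right (hτ.hFun_mono hU ?_) _
  refine mul_le_of_le_one_left (hZ0 ω) ?_
  rcases Nat.eq_zero_or_pos n with rfl | hn
  · simp
  · rw [div_le_one (by positivity)]; exact_mod_cast hn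

lemma tendsto_hFun_div (hτ : IsTransformation τ)
    (hlim : Tendsto (ddtran τ) (𝓝[>] (0 : ℝ)) (𝓝 ∞)) (z : ℝ) :
    Tendsto (fun n : ℕ => hFun τ (1 / n * z)) atTop (𝓝 0) := by
  rw [ENNReal.tendsto_nhds_zero]
  intro ε hε
  have h1 : Tendsto (fun x => (ddtran τ x)⁻¹) (𝓝[>] (0 : ℝ)) (𝓝 0) := by
    simpa using tendsto_inv_iff.2 hlim
  obtain ⟨η, hηε, hη⟩ := ((h1.eventually (gt_mem_nhds hε)).and self_mem_nhdsWithin).exists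
  have hη' : 0 < η / 7 := by have : (0 : ℝ) < η := hη; positivity
  have h2 : Tendsto (fun n : ℕ => 12 * (1 / (n : ℝ) * z)) atTop (𝓝 (12 * (0 * z))) :=
    (tendsto_one_div_atTop_nhds_zero_nat.mul_const z).const_mul 12
  simp only [zero_mul, mul_zero] at h2
  filter_upwards [h2.eventually (gt_mem_nhds (hτ.dtran_pos hη'))] with n hn
  have h3 : invdtran τ (12 * (1 / n * z)) ≤ η / 7 := by
    refine Real.sSup_le (fun x hx => ?_) hη'.le
    by_contra! h
    linarith [hτ.dtran_mono h.le, hx.2]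
  refine le_trans ?_ hηε.le
  exact ENNReal.inv_le_inv.2 (hτ.ddtran_antitone (by linarith))

lemma tendsto_lintegral_sq_hFun_div (hτ : IsTransformation τ)
    (hU : ∀ B, ∃ x, 0 < x ∧ B < dtran τ x) (hZm : AEMeasurable Z P) (hZ0 : ∀ ω, 0 ≤ Z ω)
    (hC : ∫⁻ ω, ENNReal.ofReal (Z ω ^ 2) * hFun τ (Z ω) ∂P < ∞)
    (hlim : Tendsto (ddtran τ) (𝓝[>] (0 : ℝ)) (𝓝 ∞)) :
    Tendsto (fun n : ℕ => ∫⁻ ω, ENNReal.ofReal (Z ω ^ 2) * hFun τ (1 / n * Z ω) ∂P) atTop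
      (𝓝 0) := by
  have hh := (hτ.hFun_mono hU).measurable
  have key := tendsto_lintegral_of_dominated_convergence' (μ := P)
    (F := fun (n : ℕ) ω => ENNReal.ofReal (Z ω ^ 2) * hFun τ (1 / n * Z ω)) (f := fun _ => 0)
    (fun ω => ENNReal.ofReal (Z ω ^ 2) * hFun τ (Z ω))
    (fun n => ((hZm.pow_const 2).ennreal_ofReal).mul
      (hh.comp_aemeasurable (hZm.const_mul _))) ?_ hC.ne ?_
  · simpa using key
  · refine fun n => Eventually.of_forall fun ω => mul_le_mul_right (hτ.hFun_mono hU ?_) _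
    refine mul_le_of_le_one_left (hZ0 ω) ?_
    rcases Nat.eq_zero_or_pos n with rfl | hn
    · simp
    · rw [div_le_one (by positivity)]; exact_mod_cast hn
  · refine Eventually.of_forall fun ω => ?_
    have := ENNReal.Tendsto.const_mul (a := ENNReal.ofReal (Z ω ^ 2))
      (tendsto_hFun_div hτ hlim (Z ω)) (Or.inr ENNReal.ofReal_ne_top)
    simpa using this

/-- The reciprocal curvature at the mean of `n + 1` copies is asymptotically at most the one at
twice the expectation. -/
lemma exists_tendsto_lintegral_sq_invCurv_le (hτ : IsTransformation τ)
    (hU : ∀ B, ∃ x, 0 < x ∧ B < dtran τ x) (hind : iIndepFun X P)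
    (hid : ∀ i, IdentDistrib (X i) Z P P) (hX0 : ∀ i ω, 0 ≤ X i ω) (hZ0 : ∀ ω, 0 ≤ Z ω)
    (hC : ∫⁻ ω, ENNReal.ofReal (Z ω ^ 2) * hFun τ (Z ω) ∂P < ∞) (hσ : 0 < ∫ ω, Z ω ∂P) :
    ∃ r : ℕ → ℝ≥0∞, Tendsto r atTop (𝓝 0) ∧ ∀ n : ℕ, 2 ≤ n →
      ∫⁻ ω, ENNReal.ofReal (X n ω ^ 2) *
        invCurv τ (1 / (n : ℝ) * ∑ j ∈ Finset.range n, X j ω + 1 / n * X n ω) ∂P ≤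
      (∫⁻ ω, ENNReal.ofReal (Z ω ^ 2) ∂P) * invCurv τ (2 * ∫ ω, Z ω ∂P) + r n := by
  have hZm : AEMeasurable Z P := (hid 0).aemeasurable_snd
  have hZ := memLp_two_of_lintegral_hFun hτ hU hZm hZ0 hC
  have hXm : ∀ i, AEMeasurable (X i) P := fun i => (hid i).aemeasurable_fst
  have hh := (hτ.hFun_mono hU).measurable
  have hsq : Measurable fun x : ℝ => ENNReal.ofReal (x ^ 2) :=
    (measurable_id.pow_const 2).ennreal_ofReal
  set σ := ∫ ω, Z ω ∂P with hσd
  set σ2 := ∫⁻ ω, ENNReal.ofReal (Z ω ^ 2) ∂P with hσ2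
  have hσ2top : σ2 ≠ ∞ :=
    (lintegral_ofReal_ne_top_iff_integrable (hZm.pow_const 2).aestronglyMeasurable
      (Eventually.of_forall fun ω => sq_nonneg _)).2
      ((memLp_two_iff_integrable_sq hZm.aestronglyMeasurable).1 hZ)
  set u : ℕ → ℝ → ℝ≥0∞ := fun n =>
    Set.indicator {x : ℝ | n * σ / 2 < x} fun x => ENNReal.ofReal (x ^ 2) * hFun τ x with hu
  have hum : ∀ n, Measurable (u n) := fun n => (hsq.mul hh).indicator measurableSet_Ioi
  set w : ℕ → ℝ → ℝ≥0∞ := fun n =>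
    Set.indicator {x : ℝ | 3 / 2 * σ < 1 / (n : ℝ) * x} fun x => hFun τ (1 / (n : ℝ) * x) with hw
  have hwm : ∀ n, Measurable (w n) := fun n =>
    (hh.comp (measurable_id.const_mul _)).indicator
      (measurableSet_lt measurable_const (measurable_id.const_mul _))
  have hu0 : Tendsto (fun n => ∫⁻ ω, u n (Z ω) ∂P) atTop (𝓝 0) := by
    have key := tendsto_lintegral_of_dominated_convergence' (μ := P)
      (F := fun (n : ℕ) ω => u n (Z ω)) (f := fun _ => 0)
      (fun ω => ENNReal.ofReal (Z ω ^ 2) * hFun τ (Z ω))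
      (fun n => (hum n).comp_aemeasurable hZm)
      (fun n => Eventually.of_forall fun ω => indicator_le_self _ _ _) hC.ne ?_
    · simpa using key
    · refine Eventually.of_forall fun ω => tendsto_const_nhds.congr' ?_
      have h1 : Tendsto (fun n : ℕ => (n : ℝ) * (σ / 2)) atTop atTop :=
        tendsto_natCast_atTop_atTop.atTop_mul_const (by positivity)
      filter_upwards [h1.eventually_ge_atTop (Z ω)] with n hn
      rw [hu]
      dsimp only
      rw [indicator_of_notMem]
      rw [mem_ofPred_eq, not_lt]
      linarith
  have hw0 : Tendsto (fun n : ℕ => σ2 * ∫⁻ ω, w n (∑ j ∈ Finset.range n, X j ω) ∂P) atTop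
      (𝓝 0) := by
    have h1 := tendsto_lintegral_mean_tail hind hid hZ (hτ.hFun_mono hU) (hτ.hFun_lt_top hU) hσ hC
    have h2 := ENNReal.Tendsto.const_mul (a := σ2) h1 (Or.inr hσ2top)
    rw [mul_zero] at h2
    exact h2
  refine ⟨fun n => ∫⁻ ω, u n (Z ω) ∂P + σ2 * ∫⁻ ω, w n (∑ j ∈ Finset.range n, X j ω) ∂P,
    by simpa using hu0.add hw0, fun n hn => ?_⟩
  have hn0 : (2 : ℝ) ≤ n := by exact_mod_cast hn
  have e1 := lintegral_sq_mul_sum hind hid n (hwm n)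
  have e2 : ∫⁻ ω, u n (X n ω) ∂P = ∫⁻ ω, u n (Z ω) ∂P := ((hid n).comp (hum n)).lintegral_eq
  have hm : AEMeasurable (fun ω => ENNReal.ofReal (X n ω ^ 2)) P := hsq.comp_aemeasurable (hXm n)
  have e3 : ∫⁻ ω, ENNReal.ofReal (X n ω ^ 2) * invCurv τ (2 * σ) ∂P =
      σ2 * invCurv τ (2 * σ) := by
    rw [lintegral_mul_const'' _ hm]
    congr 1
    exact ((hid n).comp hsq).lintegral_eq
  have hmu : AEMeasurable (fun ω => u n (X n ω)) P := (hum n).comp_aemeasurable (hXm n)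
  dsimp only
  rw [← e1, ← e2, ← e3, ← lintegral_add_left' hmu, ← lintegral_add_left' (hm.mul_const _)]
  refine lintegral_mono fun ω => ?_
  set s := 1 / (n : ℝ) * ∑ j ∈ Finset.range n, X j ω with hs
  have hs0 : 0 ≤ s := mul_nonneg (by positivity) (Finset.sum_nonneg fun j _ => hX0 j ω)
  set a := X n ω with ha
  have ha0 : 0 ≤ a := hX0 n ω
  have han : 2 * (1 / n * a) ≤ a := by
    rw [← mul_assoc, mul_one_div]
    exact mul_le_of_le_one_left ha0 ((div_le_one (by linarith)).2 hn0)
  have hu' : σ / 2 < 1 / n * a → ENNReal.ofReal (a ^ 2) * hFun τ a = u n a := fun h => by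
    rw [hu]
    dsimp only
    rw [indicator_of_mem]
    rw [one_div_mul_eq_div, lt_div_iff₀ (by linarith)] at h
    rw [mem_ofPred_eq]
    linarith
  have hw' : 3 / 2 * σ < s → w n (∑ j ∈ Finset.range n, X j ω) = hFun τ s := fun h => by
    rw [hw]
    dsimp only
    rw [indicator_of_mem (by exact h)]
  -- Below σ/2 and 3σ/2 the argument stays below 2σ. Otherwise either s dominates and the tail of
  -- the average w applies, or s + a/n ≤ 4a/n ≤ 2a, where n ≥ 2 enters, and the single-jump term u
  -- applies.
  rcases le_or_gt (1 / n * a) (σ / 2) with h1 | h1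
  · rcases le_or_gt s (3 / 2 * σ) with h2 | h2
    · exact le_add_right (mul_le_mul_right (hτ.invCurv_mono hU (by linarith)) _)
    · refine le_add_left (le_add_left ?_)
      rw [hw' h2]
      exact mul_le_mul_right (hτ.invCurv_le_hFun hU (by linarith)) _
  · rcases le_or_gt s (3 * (1 / n * a)) with h2 | h2
    · refine le_add_left (le_add_right ?_)
      rw [← hu' h1]
      exact mul_le_mul_right (hτ.invCurv_le_hFun hU (by linarith)) _
    · refine le_add_left (le_add_left ?_)
      rw [hw' (by linarith)]
      exact mul_le_mul_right (hτ.invCurv_le_hFun hU (by linarith)) _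

end Asymptotics

lemma lintegral_lt_top_of_rpow {Ω : Type*} [MeasurableSpace Ω] {P : Measure Ω}
    [IsProbabilityMeasure P] {f : Ω → ℝ≥0∞} {p : ℝ} (hp : 1 ≤ p)
    (h : ∫⁻ ω, f ω ^ p ∂P < ∞) : ∫⁻ ω, f ω ∂P < ∞ := by
  have hle : ∫⁻ ω, f ω ∂P ≤ ∫⁻ ω, (1 + f ω ^ p) ∂P := by
    refine lintegral_mono fun ω => ?_
    rcases le_total (f ω) 1 with h | h
    · exact le_add_right h
    · refine le_add_left ?_
      calc f ω = f ω ^ (1 : ℝ) := (ENNReal.rpow_one _).symm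
        _ ≤ f ω ^ p := ENNReal.rpow_le_rpow_of_exponent_le h hp
  refine hle.trans_lt ?_
  rw [lintegral_add_left measurable_const, lintegral_const, measure_univ, mul_one]
  exact ENNReal.add_lt_top.2 ⟨ENNReal.one_lt_top, h⟩

end FrechetMean

/-! ### The two risk bounds. -/

theorem mainTheorem4 {Ω Q : Type*} [MeasurableSpace Ω] [MetricSpace Q] [MeasurableSpace Q]
    [BorelSpace Q] (hQ : IsHadamardSpace Q)
    (P : Measure Ω) [IsProbabilityMeasure P]
    (Y : Ω → Q) (hY : Measurable Y)
    (hYsep : ∃ A : Set Q, TopologicalSpace.IsSeparable A ∧ ∀ᵐ ω ∂P, Y ω ∈ A)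
    (Ys : ℕ → Ω → Q) (hindep : iIndepFun Ys P) (hident : ∀ i, IdentDistrib (Ys i) Y P P)
    (τ : ℝ → ℝ) (hτ : IsTransformation τ)
    (hlimsup : limsup (fun x : ℝ => (dtran τ x : EReal)) atTop = ⊤)
    (o : Q) (ho : Integrable (fun ω => dtran τ (dist (Y ω) o)) P)
    (m : Q) (hm : IsFrechetMean τ P Y o m)
    (mn : ℕ → Ω → Q)
    (hmn : ∀ n : ℕ, 1 ≤ n → ∀ᵐ ω ∂P, IsSampleFrechetMean τ n (fun j => Ys j ω) (mn n ω))
    (χ : ℝ) (hχ : IsMedian P (fun ω => dist (Y ω) m) χ) :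
    (distMoment P Y m (fun x => ENNReal.ofReal (dtran τ x) ^ (2 : ℝ) * hFun τ (dtran τ x)) < ∞ →
      Tendsto (ddtran τ) (𝓝[>] (0 : ℝ)) (𝓝 ∞) →
      ∃ δ : ℕ → ℝ≥0, Tendsto δ atTop (𝓝 0) ∧ ∀ n : ℕ, 1 ≤ n →
        risk τ P m χ (mn n) ≤
          256 / (n : ℝ≥0∞) *
            (distMoment P Y m (fun x => ENNReal.ofReal (dtran τ x) ^ (2 : ℝ)) *
              SMax τ P Y Ys m 1 n + (δ n : ℝ≥0∞))) ∧
    (∀ ε : ℝ, 0 < ε →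
      distMoment P Y m (fun x => ENNReal.ofReal (dtran τ x) ^ (2 * (1 + ε)) *
        hFun τ (dtran τ x) ^ (1 + ε)) < ∞ →
      (∀ n : ℕ, 1 ≤ n →
        ∫⁻ ω, hFun τ (2 * sigmaHat τ n (fun j => Ys j ω) m) ^ (1 + ε) ∂P < ∞) →
      distMoment P Y m (fun x => gFun τ x ^ (1 + ε)) < ∞ →
      ∃ δ : ℕ → ℝ≥0, Tendsto δ atTop (𝓝 0) ∧ ∀ n : ℕ, 1 ≤ n →
        risk τ P m χ (mn n) ≤
          256 / (n : ℝ≥0∞) *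
            (distMoment P Y m (fun x => ENNReal.ofReal (dtran τ x) ^ (2 : ℝ)) *
              (ddtran τ (4 * rZero τ P Y m χ))⁻¹ + (δ n : ℝ≥0∞))) := by
  have hU := exists_lt_dtran_of_limsup hlimsup
  have hdm : Measurable fun q : Q => dtran τ (dist q m) :=
    hτ.dtran_mono.measurable.comp (continuous_id.dist continuous_const).measurable
  set X : ℕ → Ω → ℝ := fun j ω => dtran τ (dist (Ys j ω) m) with hX
  set Z : Ω → ℝ := fun ω => dtran τ (dist (Y ω) m) with hZ
  have hX0 : ∀ j ω, 0 ≤ X j ω := fun j ω => hτ.dtran_nonneg _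
  have hZ0 : ∀ ω, 0 ≤ Z ω := fun ω => hτ.dtran_nonneg _
  have hZm : AEMeasurable Z P := (hdm.comp hY).aemeasurable
  have hid : ∀ i, IdentDistrib (X i) Z P P := fun i => (hident i).comp hdm
  have hind : iIndepFun X P := hindep.comp (fun _ q => dtran τ (dist q m)) fun _ => hdm
  have hsq : ∀ ω, ENNReal.ofReal (dtran τ (dist (Y ω) m)) ^ (2 : ℝ) = ENNReal.ofReal (Z ω ^ 2) :=
    fun ω => by rw [ENNReal.rpow_two, ENNReal.ofReal_pow (hZ0 ω)]
  have hσ2 : distMoment P Y m (fun x => ENNReal.ofReal (dtran τ x) ^ (2 : ℝ)) =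
      ∫⁻ ω, ENNReal.ofReal (Z ω ^ 2) ∂P := lintegral_congr hsq
  have hrisk : ∫⁻ ω, ENNReal.ofReal (Z ω ^ 2) * hFun τ (Z ω) ∂P < ∞ → ∀ n : ℕ, 1 ≤ n →
      risk τ P m χ (mn n) ≤ 256 / n * ∫⁻ ω, ENNReal.ofReal (X n ω ^ 2) *
        invCurv τ (1 / (n : ℝ) * ∑ j ∈ Finset.range n, X j ω + 1 / n * X n ω) ∂P := by
    intro hC n hn
    refine (risk_le hτ hQ hU hY hYsep hindep hident ho hm
      (integrable_mul_invdtran hτ hU hZm hZ0 hC) hn (hmn n hn) hχ).trans ?_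
    exact mul_le_mul_left (ENNReal.div_le_div_right (by norm_num) _) _
  have hbound := lintegral_sq_invCurv_le (P := P) hτ hU hind hid hX0
  refine ⟨fun hC hlim => ?_, fun ε hε hC hh _ => ?_⟩
  · simp only [distMoment, hsq] at hC
    have ht := tendsto_lintegral_sq_hFun_div hτ hU hZm hZ0 hC hlim
    refine ⟨fun n => (∫⁻ ω, ENNReal.ofReal (Z ω ^ 2) * hFun τ (1 / n * Z ω) ∂P).toNNReal,
      (ENNReal.tendsto_toNNReal ENNReal.zero_ne_top).comp ht, fun n hn => ?_⟩
    rw [ENNReal.coe_toNNReal ((lintegral_sq_hFun_div_le hτ hU hZ0 n).trans_lt hC).ne, hσ2]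
    refine (hrisk hC n hn).trans (mul_le_mul_right ((hbound n).trans ?_) _)
    refine add_le_add_left (mul_le_mul_right ?_ _) _
    simp only [SMax, ENNReal.rpow_one]
    exact (le_max_right _ _).trans (le_max_right _ _)
  · have hC' : ∫⁻ ω, ENNReal.ofReal (Z ω ^ 2) * hFun τ (Z ω) ∂P < ∞ := by
      refine lintegral_lt_top_of_rpow (p := 1 + ε) (by linarith) ?_
      refine lt_of_eq_of_lt (lintegral_congr fun ω => ?_) hC
      rw [ENNReal.mul_rpow_of_nonneg _ _ (by linarith), ← hsq, ← ENNReal.rpow_mul]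
    set b : ℕ → ℝ≥0∞ := fun n => ∫⁻ ω, ENNReal.ofReal (X n ω ^ 2) *
        invCurv τ (1 / (n : ℝ) * ∑ j ∈ Finset.range n, X j ω + 1 / n * X n ω) ∂P with hb
    have hσ2top : ∫⁻ ω, ENNReal.ofReal (Z ω ^ 2) ∂P ≠ ∞ :=
      (lintegral_ofReal_ne_top_iff_integrable (hZm.pow_const 2).aestronglyMeasurable
        (Eventually.of_forall fun ω => sq_nonneg _)).2
        ((memLp_two_iff_integrable_sq hZm.aestronglyMeasurable).1
          (memLp_two_of_lintegral_hFun hτ hU hZm hZ0 hC'))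
    -- Needed for every n, including n = 1: an infinite b_n would be sent to 0 by `toNNReal`.
    have hbtop : ∀ n, 1 ≤ n → b n < ∞ := fun n hn => by
      refine (hbound n).trans_lt (ENNReal.add_lt_top.2 ⟨ENNReal.mul_lt_top hσ2top.lt_top
        (lintegral_lt_top_of_rpow (p := 1 + ε) (by linarith) (hh n hn)),
        (lintegral_sq_hFun_div_le hτ hU hZ0 n).trans_lt hC'⟩)
    set c := (∫⁻ ω, ENNReal.ofReal (Z ω ^ 2) ∂P) * (ddtran τ (4 * rZero τ P Y m χ))⁻¹ with hc
    have hlim : ∃ r : ℕ → ℝ≥0∞, Tendsto r atTop (𝓝 0) ∧ ∀ n : ℕ, 2 ≤ n → b n ≤ c + r n := by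
      -- The tail estimates divide by σ; if σ = 0, then X_n = 0 almost surely and b_n vanishes.
      rcases eq_or_lt_of_le (integral_nonneg hZ0 : 0 ≤ ∫ ω, Z ω ∂P) with h | h
      · refine ⟨fun _ => 0, tendsto_const_nhds, fun n _ => ?_⟩
        have hZae := (integral_eq_zero_iff_of_nonneg hZ0
          (integrable_dtran_dist hτ hY ho m)).1 h.symm
        have hXae : ∀ᵐ ω ∂P, X n ω = 0 :=
          (hid n).symm.ae_mem_snd (t := {0}) (measurableSet_singleton 0) hZae
        have hb0 : b n = 0 := by
          rw [hb]
          dsimp only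
          rw [lintegral_congr_ae (hXae.mono fun ω hω => ?_), lintegral_zero]
          simp [hω]
        rw [hb0]
        exact zero_le
      · obtain ⟨r, hr, hle⟩ := exists_tendsto_lintegral_sq_invCurv_le hτ hU hind hid hX0 hZ0 hC' h
        refine ⟨r, hr, fun n hn => (hle n hn).trans
          (add_le_add_left (mul_le_mul_right ?_ _) _)⟩
        refine ENNReal.inv_le_inv.2 (hτ.ddtran_antitone ?_)
        have h1 : invdtran τ (6 * (2 * ∫ ω, Z ω ∂P)) ≤ invdtran τ (16 * sigma τ P Y m) :=
          hτ.invdtran_mono hU (by change _ ≤ 16 * ∫ ω, Z ω ∂P; linarith)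
        have h2 : 2 * invdtran τ (16 * sigma τ P Y m) ≤ rZero τ P Y m χ := le_max_right _ _
        linarith [invdtran_nonneg (τ := τ) (16 * sigma τ P Y m)]
    obtain ⟨r, hr, hle⟩ := hlim
    refine ⟨fun n => (b n - c).toNNReal, ?_, fun n hn => ?_⟩
    · refine (ENNReal.tendsto_toNNReal ENNReal.zero_ne_top).comp
        (tendsto_of_tendsto_of_tendsto_of_le_of_le' tendsto_const_nhds hr
          (Eventually.of_forall fun _ => zero_le) ?_)
      filter_upwards [eventually_ge_atTop 2] with n hn
      exact tsub_le_iff_left.2 (hle n hn)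
    · rw [ENNReal.coe_toNNReal (tsub_le_self.trans_lt (hbtop n hn)).ne, hσ2]
      exact (hrisk hC' n hn).trans (mul_le_mul_right le_add_tsub _)
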